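/- Let $G$ be a finite directed graph. For $X\subseteq V(G)$, a *component* of $G-X$ is (the vertex set of) a strongly connected component of the digraph obtained from $G$ by deleting $X$. The following games are played on $G$ by a team of cops and a robber. A play starts at $(C_0,R_0)$ with $C_0=\emptyset$ and $R_0$ a component of $G$ chosen by the robber. In a position $(C_i,R_i)$, where $R_i$ is a component of $G-C_i$, the cops announce a set $C_{i+1}\subseteq V(G)$, and then the robber chooses a component $R_{i+1}$ of $G-C_{i+1}$ such that - in the *DAG-width (reachability) game*: $R_{i+1}$ is reachable from a vertex of $R_i$ by a directed path in $G-(C_i\cap C_{i+1})$; - in the *shy robber game*: $R_i$ and $R_{i+1}$ are contained in the same component of $G-(C_i\cap C_{i+1})$. If there is no such component, the robber is captured: we put $R_{i+1}=\emptyset$ and the play ends. The cops win a play if and only if it is finite, i.e. the robber is captured, and the play satisfies the monotonicity condition of the game. A play $(C_0,R_0),\dots,(C_n,R_n)$ is - *(strongly) cop-monotone* if $C_i\cap C_l\subseteq C_j$ for all $i<j<l\le n$; - *weakly monotone* if for all $j<i<n$, no vertex of $C_{j+1}\cap R_j$ is reachable from a vertex of $R_i$ by a directed path in $G-(C_i\cap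 C_{i+1})$. The *weakly monotone shy robber game* is the shy robber game with weak monotonicity as its condition; the *strongly monotone DAG-width game* is the DAG-width game with cop-monotonicity as its condition. We say that $k$ cops have a winning strategy in a game if there is a cop strategy (a function from histories to the next cop placement) such that the cops win every play consistent with it and $|C_i|\le k$ for every cop placement $C_i$ occurring in such a play. **Theorem.** For every finite directed graph $G$ and every $k\in\mathbb N$: if $k$ cops have a winning strategy in the weakly monotone shy robber game on $G$, then $18k^2+3k$ cops have a winning strategy in the strongly monotone DAG-width game on $G$. -/

import Mathlib

namespace GraphSearching

/-- `Reaches G X u v`: there is a directed path (possibly of length zero) from `u` to `v` in the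
digraph `G - X`, all of whose vertices, the two ends included, lie outside `X`. -/
def Reaches {V : Type*} (G : Digraph V) (X : Set V) (u v : V) : Prop :=
  u ∉ X ∧ Relation.ReflTransGen (fun a b => G.Adj a b ∧ b ∉ X) u v

/-- `R` is a strongly connected component of `G - X`, given by its set of vertices. -/
def IsComponent {V : Type*} (G : Digraph V) (X R : Set V) : Prop :=
  ∃ v, v ∉ X ∧ R = {w | Reaches G X v w ∧ Reaches G X w v}

/-- A position `(C, R)` in which the cops are to move: the cops occupy `C` and the robber
component is `R`, where `R = ∅` means that the robber has been captured.
The intermediate position `(C, C', R)` is recorded by two consecutive positions of a play. -/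
structure Position (V : Type*) where
  cops : Set V
  robber : Set V

/-- The robber moves from `(C, C', R)` to `(C', R')` in the reachability game. -/
def ReachMove {V : Type*} (G : Digraph V) (C C' R R' : Set V) : Prop :=
  IsComponent G C' R' ∧ ∃ u ∈ R, ∃ v ∈ R', Reaches G (C ∩ C') u v

/-- The robber moves from `(C, C', R)` to `(C', R')` in the component game (shy robber). -/
def CompMove {V : Type*} (G : Digraph V) (C C' R R' : Set V) : Prop :=
  IsComponent G C' R' ∧ ∃ S, IsComponent G (C ∩ C') S ∧ R ⊆ S ∧ R' ⊆ S

/-- One robber move, with `mv` the set of moves to a new component: a robber who is not yet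
captured makes a move in `mv` if there is one, and is captured if there is none.
By convention a captured robber stays captured. -/
def RobberStep {V : Type*} (mv : Set V → Set V → Set V → Set V → Prop)
    (C C' R R' : Set V) : Prop :=
  (R.Nonempty ∧ mv C C' R R') ∨ (R' = ∅ ∧ (R.Nonempty → ∀ S, ¬ mv C C' R S))

/-- A cop strategy: it maps a history `(C₀, R₀), …, (Cᵢ, Rᵢ)` to the next placement `Cᵢ₊₁`. -/
abbrev CopStrategy (V : Type*) := List (Position V) → Set V

/-- The history `π 0, …, π i`. -/
def history {V : Type*} (π : ℕ → Position V) (i : ℕ) : List (Position V) :=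
  (List.range (i + 1)).map π

/-- `π` is a play consistent with `σ`. It starts without cops, with a robber component chosen by
the robber. (A play ends when the robber is captured; what follows in `π` is irrelevant.) -/
def IsConsistentPlay {V : Type*} (G : Digraph V)
    (mv : Set V → Set V → Set V → Set V → Prop) (σ : CopStrategy V)
    (π : ℕ → Position V) : Prop :=
  (π 0).cops = ∅ ∧ IsComponent G ∅ (π 0).robber ∧
    ∀ i, (π (i + 1)).cops = σ (history π i) ∧
      RobberStep mv (π i).cops (π (i + 1)).cops (π i).robber (π (i + 1)).robber

/-- The finite play `π 0, …, π n` is cop-monotone: the cops never reoccupy a vertex. -/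
def CopMonotone {V : Type*} (π : ℕ → Position V) (n : ℕ) : Prop :=
  ∀ i j k, i < j → j < k → k ≤ n → (π i).cops ∩ (π k).cops ⊆ (π j).cops

/-- The chasers of round `i`: the cops moving into the current robber component. -/
def chasers {V : Type*} (π : ℕ → Position V) (i : ℕ) : Set V :=
  (π (i + 1)).cops ∩ (π i).robber

/-- The finite play `π 0, …, π n` is weakly monotone: in no round `i` is a vertex taken by a
chaser in an earlier round reachable from the robber component by a path avoiding the cops that
remain on the board. -/
def WeaklyMonotone {V : Type*} (G : Digraph V) (π : ℕ → Position V) (n : ℕ) : Prop :=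
  ∀ i j, j < i → i < n → ∀ u ∈ (π i).robber, ∀ v ∈ chasers π j,
    ¬ Reaches G ((π i).cops ∩ (π (i + 1)).cops) u v

/-- `k` cops have a winning strategy in the game with robber moves `mv` and monotonicity
condition `Mon`, a set of finite plays: in each consistent play the robber is captured, in some
round `n`, the play up to then satisfies `Mon`, and never more than `k` vertices are occupied. -/
def CopsWin {V : Type*} (G : Digraph V) (mv : Set V → Set V → Set V → Set V → Prop)
    (Mon : (ℕ → Position V) → ℕ → Prop) (k : ℕ) : Prop :=
  ∃ σ : CopStrategy V, ∀ π, IsConsistentPlay G mv σ π →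
    ∃ n, (π n).robber = ∅ ∧ (∀ i < n, (π i).robber.Nonempty) ∧ Mon π n ∧
      ∀ i ≤ n, (π i).cops.encard ≤ k

/-- `k` cops have a winning strategy in the weakly monotone shy robber game. -/
def CopsWinWeaklyMonotoneShy {V : Type*} (G : Digraph V) (k : ℕ) : Prop :=
  CopsWin G (CompMove G) (WeaklyMonotone G) k

/-- `k` cops have a winning strategy in the strongly (cop-)monotone DAG-width game. -/
def CopsWinStronglyMonotone {V : Type*} (G : Digraph V) (k : ℕ) : Prop :=
  CopsWin G (ReachMove G) CopMonotone k

end GraphSearching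

/-!
A winning strategy of the cops in the weakly monotone shy robber game orders the vertices: on each
strongly connected set, the vertices that the cops attack come last, and weak monotonicity provides
for every strongly connected set `A` a superset of out-degree less than `k` that avoids all later
vertices `A` could be merged with (`HasHullOrder`, `hasHullOrder_of_strategy`). Since the out-degree
`(outNbr G T).ncard` is submodular in `T`, the supersets of least out-degree can be uncrossed. They
form a hull system (`IsHullSystem`, `HasHullOrder.exists_isHullSystem`): the hull `T A` of `A` is
reachable from `A`, contains the hulls of all strongly connected subsets of `T A`, and removing the
top vertex of `A` from `T A` preserves this last property.

In the reachability game, the cops clear the robber territory `U` while keeping its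
out-neighbourhood occupied, so no vertex is ever reoccupied (`WinsFrom`,
`copsWinStronglyMonotone_of_winsFrom`). Only `outNbr G U` has to be kept small, and for this the
hull system is used as follows. In a stage (`Stage`), the territory `U₀` lies in a hull-closed set
`D`. Let `A` be the component of `D` in which `U₀` is rooted. Its top vertex is occupied, and what
else can be reached from `A` in `D` is covered by `P = T A \ {top A}` and further components of `D`.
These are removed in topological order, with a source component `F` first (`Filling`). If few
vertices of `F` border on `U₀`, it is enough to separate `F` from the rest: the robber either never
enters `F`, or is in `F`, and then `T F` replaces `P`.

If many vertices of `F` border on `U₀`, then there is essentially one chain of heavy nodes in `F`,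
because the border of `U₀` is balanced. The robber is confined to smaller and smaller pockets around
the hulls of these nodes (`IsPocket`, `Stage.winsFrom_of_inPocket`). If it escapes from a pocket, it
either loses contact with the heavy node `L`, and with it with a large part of the border, or it
shares a component `K` with `L`, which shrinks as its top vertex is occupied
(`Stage.winsFrom_of_mem_component`). When all components of the stage are removed, a new stage
begins on a smaller set.

At any time, the robber territory borders on `O(k)` vertices occupied during the current stage. The
bound `O(k ^ 2)` on those occupied earlier comes from the invariant `Spread`: the old border
vertices outside a central component are paid for, `O(k)` at a time, by out-neighbours of a hull, of
which there are fewer than `k`. It survives a retreat of the robber by `Stage.spread_of_subset`.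

For the constants, let `k = j + 1`. When the robber loses contact with a heavy node, up to
`6 * j + 4` vertices of `F` have been occupied during the stage: `4 * j + 2` for the escape from the
pocket, and `j + 1` for each of two successive components `K`. A node is heavy if it contains more
than `6 * j + 3` of the at most `10 * j + 6` vertices of `F` bordering on `U₀`. So at most
`4 * j + 2` of these remain relevant, and together with the newly occupied ones there are again at
most `10 * j + 6`. If the robber is confined to the hull of `L` instead, it may border on all
`10 * j + 6` old vertices and on `4 * j + 3` new ones, hence the bound `14 * j + 9` in `Spread`.
-/

namespace GraphSearching
variable {V : Type*} {G : Digraph V}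

/-! ### Reachability inside a set of vertices -/

/-- `v` is reachable from `u` by a directed path all of whose vertices lie in `U`. By definition,
`Reaches G X` is `ReachIn G Xᶜ`. -/
def ReachIn (G : Digraph V) (U : Set V) (u v : V) : Prop :=
  u ∈ U ∧ Relation.ReflTransGen (fun a b => G.Adj a b ∧ b ∈ U) u v

/-- The set of vertices outside `U` that have an in-neighbour in `U`. -/
def outNbr (G : Digraph V) (U : Set V) : Set V := {w | w ∉ U ∧ ∃ u ∈ U, G.Adj u w}

/-- The set of vertices reachable from `r` inside `U`. -/
def reachSet (G : Digraph V) (U : Set V) (r : V) : Set V := {v | ReachIn G U r v}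

/-- `A` is nonempty and its vertices reach each other inside `A`; unlike a component, `A` need not
be maximal. -/
def StronglyConn (G : Digraph V) (A : Set V) : Prop :=
  A.Nonempty ∧ ∀ u ∈ A, ∀ v ∈ A, ReachIn G A u v

/-- The strongly connected component of `r` in the subgraph induced by `U`. -/
def sccOf (G : Digraph V) (U : Set V) (r : V) : Set V :=
  {v | ReachIn G U r v ∧ ReachIn G U v r}

/-- All vertices of `U` are reachable from `r` inside `U`. -/
def Rooted (G : Digraph V) (r : V) (U : Set V) : Prop := r ∈ U ∧ ∀ v ∈ U, ReachIn G U r v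

namespace ReachIn
variable {U S : Set V} {u v w : V}

theorem refl (h : u ∈ U) : ReachIn G U u u := ⟨h, .refl⟩

theorem left_mem (h : ReachIn G U u v) : u ∈ U := h.1

theorem right_mem (h : ReachIn G U u v) : v ∈ U := by
  obtain ⟨h1, h2⟩ := h
  induction h2 with
  | refl => exact h1
  | tail _ h _ => exact h.2

theorem trans (h : ReachIn G U u v) (h' : ReachIn G U v w) : ReachIn G U u w :=
  ⟨h.1, h.2.trans h'.2⟩

theorem mono (hUS : U ⊆ S) (h : ReachIn G U u v) : ReachIn G S u v :=
  ⟨hUS h.1, Relation.ReflTransGen.mono (fun _ _ hab => ⟨hab.1, hUS hab.2⟩) _ _ h.2⟩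

theorem tail (h : ReachIn G U u v) (hvw : G.Adj v w) (hw : w ∈ U) : ReachIn G U u w :=
  ⟨h.1, h.2.tail ⟨hvw, hw⟩⟩

/-- A path inside `U` that starts in `S` either stays in `S` or has a first vertex outside `S`. -/
theorem exit (h : ReachIn G U u v) (hu : u ∈ S) :
    ReachIn G (U ∩ S) u v ∨
      ∃ x y, ReachIn G (U ∩ S) u x ∧ G.Adj x y ∧ y ∈ U ∧ y ∉ S ∧ ReachIn G U y v := by
  obtain ⟨h1, h2⟩ := h
  induction h2 with
  | refl => exact .inl (refl ⟨h1, hu⟩)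
  | @tail b c hb hbc ih =>
    rcases ih with ih | ⟨x, y, hx, hxy, hy, hyS, hyb⟩
    · by_cases hc : c ∈ S
      · exact .inl (ih.tail hbc.1 ⟨hbc.2, hc⟩)
      · exact .inr ⟨b, c, ih, hbc.1, hbc.2, hc, refl hbc.2⟩
    · exact .inr ⟨x, y, hx, hxy, hy, hyS, hyb.tail hbc.1 hbc.2⟩

/-- If no edge of `U` leaves `S`, then paths inside `U` starting in `S` stay in `S`. -/
theorem inter_of_closed (h : ReachIn G U u v) (hu : u ∈ S)
    (hS : ∀ x ∈ U ∩ S, ∀ y ∈ U, G.Adj x y → y ∈ S) : ReachIn G (U ∩ S) u v := by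
  rcases h.exit hu with h | ⟨x, y, hx, hxy, hy, hyS, -⟩
  · exact h
  · exact absurd (hS x hx.right_mem y hy hxy) hyS

theorem mem_of_closed (h : ReachIn G U u v) (hu : u ∈ S)
    (hS : ∀ x ∈ U ∩ S, ∀ y ∈ U, G.Adj x y → y ∈ S) : v ∈ S :=
  (h.inter_of_closed hu hS).right_mem.2

/-- The vertices of a path from `u` to `v` are reachable from `u` and reach `v`. -/
theorem between (h : ReachIn G U u v) :
    ReachIn G {w | ReachIn G U u w ∧ ReachIn G U w v} u v := by
  obtain ⟨h1, h2⟩ := h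
  induction h2 with
  | refl => exact refl ⟨refl h1, refl h1⟩
  | @tail b c hb hbc ih =>
    have hub : ReachIn G U u b := ⟨h1, hb⟩
    have hc : ReachIn G U b c := (refl hub.right_mem).tail hbc.1 hbc.2
    exact ReachIn.tail (ih.mono fun w hw => ⟨hw.1, hw.2.trans hc⟩) hbc.1
      ⟨hub.trans hc, refl hbc.2⟩

end ReachIn

theorem outNbr_subset_union {U U' : Set V} (h : U ⊆ U') : outNbr G U ⊆ outNbr G U' ∪ U' := by
  rintro w ⟨-, u, hu, huw⟩
  by_cases hw : w ∈ U'
  · exact .inr hw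
  · exact .inl ⟨hw, u, h hu, huw⟩

theorem Rooted.extend {r x : V} {U : Set V} (h : Rooted G r U) (hx : x ∈ outNbr G U) :
    ReachIn G (insert x U) r x := by
  obtain ⟨-, u, hu, hux⟩ := hx
  exact ((h.2 u hu).mono (Set.subset_insert x U)).tail hux (Set.mem_insert x U)

theorem reachSet_subset {U : Set V} {r : V} : reachSet G U r ⊆ U := fun _ h => h.right_mem

theorem rooted_reachSet {U : Set V} {r : V} (h : r ∈ U) : Rooted G r (reachSet G U r) :=
  ⟨.refl h, fun _ hv => hv.between.mono fun _ hw => hw.1⟩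

theorem outNbr_reachSet {U : Set V} {r : V} : outNbr G (reachSet G U r) ⊆ outNbr G U := by
  rintro w ⟨hw, u, hu, huw⟩
  exact ⟨fun h => hw (ReachIn.tail hu huw h), u, reachSet_subset hu, huw⟩

theorem outNbr_reachSet_diff {U W : Set V} {r : V} :
    outNbr G (reachSet G (U \ W) r) ⊆ outNbr G U ∪ W := by
  rintro w ⟨hw, u, hu, huw⟩
  by_cases hwU : w ∈ U
  · by_cases hwW : w ∈ W
    · exact .inr hwW
    · exact absurd (ReachIn.tail hu huw ⟨hwU, hwW⟩) hw
  · exact .inl ⟨hwU, u, (reachSet_subset hu).1, huw⟩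

theorem Rooted.reachSet_eq {U : Set V} {r : V} (h : Rooted G r U) : reachSet G U r = U :=
  reachSet_subset.antisymm h.2

/-! ### Strongly connected sets -/

theorem StronglyConn.union {A B : Set V} (hA : StronglyConn G A) (hB : StronglyConn G B)
    (h : (A ∩ B).Nonempty) : StronglyConn G (A ∪ B) := by
  obtain ⟨x, hxA, hxB⟩ := h
  have h1 : ∀ u ∈ A ∪ B, ReachIn G (A ∪ B) u x ∧ ReachIn G (A ∪ B) x u := by
    rintro u (hu | hu)
    · exact ⟨(hA.2 u hu x hxA).mono Set.subset_union_left,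
        (hA.2 x hxA u hu).mono Set.subset_union_left⟩
    · exact ⟨(hB.2 u hu x hxB).mono Set.subset_union_right,
        (hB.2 x hxB u hu).mono Set.subset_union_right⟩
  exact ⟨⟨x, .inl hxA⟩, fun u hu v hv => (h1 u hu).1.trans (h1 v hv).2⟩

theorem sccOf_subset {U : Set V} {r : V} : sccOf G U r ⊆ U := fun _ h => h.1.right_mem

theorem mem_sccOf {U : Set V} {r : V} (h : r ∈ U) : r ∈ sccOf G U r := ⟨.refl h, .refl h⟩

theorem stronglyConn_sccOf {U : Set V} {r : V} (h : r ∈ U) : StronglyConn G (sccOf G U r) := by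
  refine ⟨⟨r, mem_sccOf h⟩, fun u hu v hv => ?_⟩
  exact (hu.2.trans hv.1).between.mono fun w hw => ⟨hu.1.trans hw.1, hw.2.trans hv.2⟩

theorem StronglyConn.subset_sccOf {A U : Set V} {r x : V} (hA : StronglyConn G A) (hAU : A ⊆ U)
    (hx : x ∈ A) (hxr : x ∈ sccOf G U r) : A ⊆ sccOf G U r := fun y hy =>
  ⟨hxr.1.trans ((hA.2 x hx y hy).mono hAU), ((hA.2 y hy x hx).mono hAU).trans hxr.2⟩

/-- `F` is a maximal strongly connected subset of `U`. -/
structure IsScc (G : Digraph V) (U F : Set V) : Prop where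
  conn : StronglyConn G F
  subset : F ⊆ U
  max : ∀ A, StronglyConn G A → A ⊆ U → (A ∩ F).Nonempty → A ⊆ F

theorem isScc_sccOf {U : Set V} {r : V} (h : r ∈ U) : IsScc G U (sccOf G U r) where
  conn := stronglyConn_sccOf h
  subset := sccOf_subset
  max _ hA hAU := fun ⟨_, hx, hxr⟩ => hA.subset_sccOf hAU hx hxr

/-- A vertex reaching a component and reachable from it belongs to it. -/
theorem IsScc.mem {U F : Set V} (h : IsScc G U F) {x y z : V} (hx : x ∈ F) (hz : z ∈ F)
    (hxy : ReachIn G U x y) (hyz : ReachIn G U y z) : y ∈ F := by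
  have hxU := h.subset hx
  refine h.max _ (stronglyConn_sccOf (r := x) hxU) sccOf_subset ⟨x, mem_sccOf hxU, hx⟩ ⟨hxy, ?_⟩
  exact hyz.trans ((h.conn.2 z hz x hx).mono h.subset)

theorem IsScc.subset_or_disjoint {U F A : Set V} (h : IsScc G U F) (hA : StronglyConn G A)
    (hAU : A ⊆ U) : A ⊆ F ∨ Disjoint A F := by
  by_cases hn : (A ∩ F).Nonempty
  · exact .inl (h.max A hA hAU hn)
  · exact .inr (Set.disjoint_iff_inter_eq_empty.2 (Set.not_nonempty_iff_eq_empty.1 hn))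

/-! ### Positional winning and hull systems -/

/-- The cops win from the robber territory `U`, whose out-neighbourhood they occupy, without ever
giving up territory: they add the vertices of some `W ⊆ U`, occupying at most `q` vertices, and win
from every territory `reachSet G (U \ W) r` into which the robber can retreat. -/
inductive WinsFrom (G : Digraph V) (q : ℕ) : Set V → Prop
  | place (U W : Set V) (hWU : W ⊆ U) (hq : (outNbr G U ∪ W).ncard ≤ q)
      (h : ∀ r ∈ U \ W, WinsFrom G q (reachSet G (U \ W) r)) : WinsFrom G q U

/-- A *hull system* assigns to every strongly connected set `A` a vertex `top A`, its maximum in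
some order, and a hull `T A ⊇ A` of out-degree at most `j`. A hull is spanned by `A` (`reachIn`),
avoids the tops of the sets in which `A` is merged with greater vertices (`top_notMem`), and
contains the hull of each strongly connected `B` it contains (`hull_mono`), which misses `top A` if
`B` does (`top_notMem_hull`). The value at `∅` lets the empty set stand for a missing set. -/
structure IsHullSystem (G : Digraph V) (j : ℕ) (top : Set V → V) (T : Set V → Set V) : Prop where
  top_mem : ∀ {A}, StronglyConn G A → top A ∈ A
  top_eq : ∀ {A B}, StronglyConn G A → StronglyConn G B → A ⊆ B → top B ∈ A → top B = top A
  hull_empty : T ∅ = ∅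
  subset_hull : ∀ {A}, StronglyConn G A → A ⊆ T A
  card_outNbr : ∀ {A}, StronglyConn G A → (outNbr G (T A)).ncard ≤ j
  reachIn : ∀ {A}, StronglyConn G A → ∀ v ∈ T A, ∃ u ∈ A, ReachIn G (T A) u v
  top_notMem : ∀ {A K}, StronglyConn G A → StronglyConn G K → A ⊆ K → top K ≠ top A → top K ∉ T A
  hull_mono : ∀ {A B}, StronglyConn G A → StronglyConn G B → B ⊆ T A → T B ⊆ T A
  top_notMem_hull : ∀ {A B}, StronglyConn G A → StronglyConn G B → B ⊆ T A \ {top A} → top A ∉ T B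

/-- `P` contains the hull of each of its strongly connected subsets. -/
def HullClosed (G : Digraph V) (T : Set V → Set V) (P : Set V) : Prop :=
  ∀ A, StronglyConn G A → A ⊆ P → T A ⊆ P

/-- Seen from the vertices of `U`, the marked set `X` is spread thinly over `H`: from `r`, paths in
`H` reach at most `s` vertices of `X` in a strongly connected set `C` around `r`, and outside `C`
paths in a subset `S` of `H` reach at most `s` vertices of `X` for each vertex of `outNbr G S`
outside `C`. -/
def Spread (G : Digraph V) (s : ℕ) (X H U : Set V) : Prop :=
  ∀ r ∈ U, ∃ C, StronglyConn G C ∧ (∀ A, StronglyConn G A → A ⊆ H → r ∈ A → A ⊆ C) ∧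
    {x ∈ X ∩ C | ReachIn G H r x}.ncard ≤ s ∧
    ∀ S ⊆ H, {x ∈ X \ C | ReachIn G S r x}.ncard ≤ s * (outNbr G S \ C).ncard

theorem Spread.mono [Finite V] {s : ℕ} {X X' H H' U U' : Set V} (h : Spread G s X H U)
    (hX : X' ⊆ X) (hH : H' ⊆ H) (hU : U' ⊆ U) : Spread G s X' H' U' := by
  intro r hr
  obtain ⟨C, hC, hmax, h1, h2⟩ := h r (hU hr)
  refine ⟨C, hC, fun A hA hAH => hmax A hA (hAH.trans hH), ?_, fun S hS => ?_⟩
  · refine (Set.ncard_le_ncard fun x hx => ?_).trans h1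
    exact ⟨⟨hX hx.1.1, hx.1.2⟩, hx.2.mono hH⟩
  · refine (Set.ncard_le_ncard fun x hx => ?_).trans (h2 S (hS.trans hH))
    exact ⟨⟨hX hx.1.1, hx.1.2⟩, hx.2⟩

/-! ### Stages and slices -/

/-- The situation at the start of a stage of the cops' strategy: the robber territory `U₀` lies in
`D`, and the vertices of `D` bordering on `U₀` are few in every strongly connected subset of `D`,
and spread over a hull `H ⊇ D`. -/
structure Stage (G : Digraph V) (j : ℕ) (T : Set V → Set V) (D H U₀ : Set V) : Prop where
  closed : HullClosed G T D
  subset_hull : D ⊆ H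
  card_outNbr : (outNbr G D).ncard ≤ 2 * j + 2
  card_hull : (outNbr G H).ncard ≤ j
  subset : U₀ ⊆ D
  rooted : ∃ r, Rooted G r U₀
  balanced : ∀ Q, StronglyConn G Q → Q ⊆ D → (outNbr G U₀ ∩ Q).ncard ≤ 10 * j + 6
  spread : Spread G (14 * j + 9) (outNbr G U₀ ∩ D) H U₀

section
variable {j : ℕ} {top : Set V → V} {T : Set V → Set V} {D H U₀ : Set V} {a : V}

/-- `F` is a component of `D`, and no edge of `D` leaves `E` or `F ∪ E`. -/
structure IsSlice (G : Digraph V) (D F E : Set V) : Prop where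
  scc : IsScc G D F
  subset : E ⊆ D
  disj : Disjoint F E
  closed : ∀ x ∈ E, ∀ y ∈ D, G.Adj x y → y ∈ E
  closed_union : ∀ x ∈ F ∪ E, ∀ y ∈ D, G.Adj x y → y ∈ F ∪ E

namespace IsSlice
variable {F E : Set V}

theorem union_subset (h : IsSlice G D F E) : F ∪ E ⊆ D := Set.union_subset h.scc.subset h.subset

theorem subset_or_subset (h : IsSlice G D F E) {Q : Set V} (hQ : StronglyConn G Q)
    (hQE : Q ⊆ F ∪ E) : Q ⊆ F ∨ Q ⊆ E := by
  rcases h.scc.subset_or_disjoint hQ (hQE.trans h.union_subset) with h1 | h1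
  · exact .inl h1
  · exact .inr fun x hx => (hQE hx).resolve_left fun hxF => Set.disjoint_left.1 h1 hx hxF

theorem mem_of_reachIn (h : IsSlice G D F E) {x y : V} (hxy : ReachIn G D x y) (hx : x ∈ E) :
    y ∈ E :=
  hxy.mem_of_closed hx fun u hu v hv => h.closed u hu.2 v hv

theorem mem_union_of_reachIn (h : IsSlice G D F E) {x y : V} (hxy : ReachIn G D x y)
    (hx : x ∈ F ∪ E) : y ∈ F ∪ E :=
  hxy.mem_of_closed hx fun u hu v hv => h.closed_union u hu.2 v hv

theorem hull_subset (h : IsSlice G D F E) (hT : IsHullSystem G j top T) (hD : HullClosed G T D)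
    {A : Set V} (hA : StronglyConn G A) (hAE : A ⊆ E) : T A ⊆ E := fun v hv => by
  obtain ⟨u, hu, huv⟩ := hT.reachIn hA v hv
  exact h.mem_of_reachIn (huv.mono (hD A hA (hAE.trans h.subset))) (hAE hu)

theorem hull_subset_union (h : IsSlice G D F E) (hT : IsHullSystem G j top T)
    (hD : HullClosed G T D) {A : Set V} (hA : StronglyConn G A) (hAE : A ⊆ F ∪ E) :
    T A ⊆ F ∪ E := fun v hv => by
  obtain ⟨u, hu, huv⟩ := hT.reachIn hA v hv
  exact h.mem_union_of_reachIn (huv.mono (hD A hA (hAE.trans h.union_subset))) (hAE hu)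

end IsSlice

variable [Finite V]

/-- The out-neighbours of `U` outside `D` are out-neighbours of `D`. Those in `D` but not in `U₀`
were occupied before the stage, and are counted by the spread of `outNbr G U₀`. -/
theorem Stage.card_outNbr_union_le (hS : Stage G j T D H U₀) {U W : Set V} {r : V}
    (hU : U ⊆ U₀) (hr : Rooted G r U)
    (hM : (outNbr G U ∩ U₀ ∪ W).ncard ≤ 14 * j + 8) :
    (outNbr G U ∪ W).ncard ≤ 18 * (j + 1) ^ 2 + 3 * (j + 1) := by
  obtain ⟨C, -, -, h1, h2⟩ := hS.spread r (hU hr.1)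
  have h3 := h2 H subset_rfl
  have hUD := hU.trans hS.subset
  have hsub : outNbr G U ∪ W ⊆ outNbr G D ∪ {x ∈ outNbr G U₀ ∩ D ∩ C | ReachIn G H r x} ∪
      {x ∈ (outNbr G U₀ ∩ D) \ C | ReachIn G H r x} ∪ (outNbr G U ∩ U₀ ∪ W) := by
    rintro x (hx | hx)
    · by_cases hx0 : x ∈ U₀
      · exact .inr (.inl ⟨hx, hx0⟩)
      · obtain ⟨u, hu, hux⟩ := hx.2
        by_cases hxD : x ∈ D
        · have hxr : ReachIn G H r x := (hr.extend hx).mono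
            (Set.insert_subset (hS.subset_hull hxD) (hUD.trans hS.subset_hull))
          have hx1 : x ∈ outNbr G U₀ := ⟨hx0, u, hU hu, hux⟩
          by_cases hxC : x ∈ C
          · exact .inl (.inl (.inr ⟨⟨⟨hx1, hxD⟩, hxC⟩, hxr⟩))
          · exact .inl (.inr ⟨⟨⟨hx1, hxD⟩, hxC⟩, hxr⟩)
        · exact .inl (.inl (.inl ⟨hxD, u, hUD hu, hux⟩))
    · exact .inr (.inr hx)
  have h4 : (outNbr G H \ C).ncard ≤ j := (Set.ncard_le_ncard Set.sdiff_subset).trans hS.card_hull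
  have h5 := Nat.mul_le_mul_left (14 * j + 9) h4
  have h6 := hS.card_outNbr
  have h7 := Set.ncard_le_ncard hsub
  have h8 := Set.ncard_union_le (outNbr G D ∪ {x ∈ outNbr G U₀ ∩ D ∩ C | ReachIn G H r x} ∪
      {x ∈ (outNbr G U₀ ∩ D) \ C | ReachIn G H r x}) (outNbr G U ∩ U₀ ∪ W)
  have h9 := Set.ncard_union_le (outNbr G D ∪ {x ∈ outNbr G U₀ ∩ D ∩ C | ReachIn G H r x})
      {x ∈ (outNbr G U₀ ∩ D) \ C | ReachIn G H r x}
  have h10 := Set.ncard_union_le (outNbr G D) {x ∈ outNbr G U₀ ∩ D ∩ C | ReachIn G H r x}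
  nlinarith

/-- One move inside a stage: placing cops on `W ⊆ U` is affordable as long as the cops on
vertices of `U₀` are few. -/
theorem Stage.winsFrom_of_place (hS : Stage G j T D H U₀) {U W : Set V} {r : V}
    (hU : U ⊆ U₀) (hr : Rooted G r U) (hWU : W ⊆ U)
    (hM : (outNbr G U ∩ U₀ ∪ W).ncard ≤ 14 * j + 8)
    (h : ∀ r₁ U₁, Rooted G r₁ U₁ → U₁ ⊆ U → Disjoint U₁ W → outNbr G U₁ ⊆ outNbr G U ∪ W →
      WinsFrom G (18 * (j + 1) ^ 2 + 3 * (j + 1)) U₁) :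
    WinsFrom G (18 * (j + 1) ^ 2 + 3 * (j + 1)) U := by
  refine .place U W hWU (hS.card_outNbr_union_le hU hr hM) fun r₁ hr₁ => ?_
  refine h r₁ _ (rooted_reachSet hr₁) (reachSet_subset.trans Set.sdiff_subset) ?_
    outNbr_reachSet_diff
  exact Set.disjoint_sdiff_left.mono_left reachSet_subset

/-- When the robber has retreated into `F ∪ E`, the vertices bordering on its territory are spread
thinly over any hull inside `D`. From a vertex `r` of `F`, the component `F` itself can serve as the
central set: a path from `r` to a bordering vertex outside `F` that lies in the old central set `C`
cannot be closed up inside `S`, so `C` contains a vertex of `outNbr G S`. -/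
theorem Stage.spread_of_subset (hS : Stage G j T D H U₀) {F E U P H' : Set V}
    (hsl : IsSlice G D F E) (hUE : U ⊆ F ∪ E) (hU : U ⊆ U₀)
    (hclean : ∀ x ∈ outNbr G U, x ∈ U₀ → x ∉ E)
    (hF : (outNbr G U ∩ F).ncard ≤ 14 * j + 9) (hH : H' ⊆ D) :
    Spread G (14 * j + 9) (outNbr G U ∩ P) H' U := by
  have key : ∀ x ∈ outNbr G U ∩ P, x ∈ E → x ∈ outNbr G U₀ ∩ D := by
    rintro x ⟨hx, hxP⟩ hxE
    obtain ⟨-, u, hu, hux⟩ := id hx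
    exact ⟨⟨fun h0 => hclean x hx h0 hxE, u, hU hu, hux⟩, hsl.subset hxE⟩
  have hHD := hH.trans hS.subset_hull
  intro r hr
  obtain ⟨C, hC, hmax, h1, h2⟩ := hS.spread r (hU hr)
  by_cases hrF : r ∈ F
  · have hFC : F ⊆ C := hmax F hsl.scc.conn (hsl.scc.subset.trans hS.subset_hull) hrF
    refine ⟨F, hsl.scc.conn, ?_, ?_, ?_⟩
    · exact fun A hA hAH hrA => hsl.scc.max A hA (hAH.trans hH) ⟨r, hrA, hrF⟩
    · exact (Set.ncard_le_ncard fun x hx => by exact ⟨hx.1.1.1, hx.1.2⟩).trans hF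
    intro S hSH
    have hxE : ∀ x, x ∈ (outNbr G U ∩ P) \ F → ReachIn G S r x → x ∈ E := fun x hx hrx =>
      (hsl.mem_union_of_reachIn (hrx.mono (hSH.trans hH)) (.inl hrF)).resolve_left hx.2
    set X1 := {x ∈ (outNbr G U₀ ∩ D) \ C | ReachIn G S r x} with hX1
    set X2 := {x ∈ (outNbr G U ∩ P) \ F | ReachIn G S r x ∧ x ∈ C} with hX2
    have hsub : {x ∈ (outNbr G U ∩ P) \ F | ReachIn G S r x} ⊆ X1 ∪ X2 := by
      rintro x ⟨hx, hrx⟩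
      by_cases hxC : x ∈ C
      · exact .inr ⟨hx, hrx, hxC⟩
      · exact .inl ⟨⟨key x hx.1 (hxE x hx hrx), hxC⟩, hrx⟩
    have hc1 : X1.ncard ≤ _ := h2 S (hSH.trans hHD)
    have hc2 : X2.ncard ≤ 14 * j + 9 := by
      refine (Set.ncard_le_ncard fun x hx => ?_).trans h1
      exact ⟨⟨key x hx.1.1 (hxE x hx.1 hx.2.1), hx.2.2⟩, hx.2.1.mono (hSH.trans hHD)⟩
    have hc3 := (Set.ncard_le_ncard hsub).trans (Set.ncard_union_le X1 X2)
    have hdiff : outNbr G S \ C ⊆ outNbr G S \ F := Set.sdiff_subset_sdiff_right hFC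
    rcases X2.eq_empty_or_nonempty with he | ⟨x, hx, hrx, hxC⟩
    · rw [he, Set.ncard_empty] at hc3
      exact (hc3.trans hc1).trans (Nat.mul_le_mul_left _ (Set.ncard_le_ncard hdiff))
    · -- the path in `C` back from `x` to `r` has to leave `S`
      have hrS := hrx.left_mem
      have hSD := hSH.trans hH
      rcases (hC.2 x hxC r (hFC hrF)).exit hrx.right_mem with h | ⟨y, z, hy, hyz, hzC, hzS, -⟩
      · refine absurd (hsl.scc.mem hrF hrF (hrx.mono hSD) ?_) hx.2
        exact h.mono (Set.inter_subset_right.trans hSD)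
      have hz : z ∈ outNbr G S \ F := by
        refine ⟨⟨hzS, y, hy.right_mem.2, hyz⟩, fun hzF => hx.2 ?_⟩
        refine hsl.scc.mem hrF hzF (hrx.mono hSD) ?_
        exact (hy.mono (Set.inter_subset_right.trans hSD)).tail hyz (hsl.scc.subset hzF)
      have hlt : (outNbr G S \ C).ncard < (outNbr G S \ F).ncard :=
        Set.ncard_lt_ncard ⟨hdiff, fun h => (h hz).2 hzC⟩
      calc _ ≤ (14 * j + 9) * (outNbr G S \ C).ncard + (14 * j + 9) := by omega
        _ = (14 * j + 9) * ((outNbr G S \ C).ncard + 1) := by ring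
        _ ≤ _ := Nat.mul_le_mul_left _ hlt
  · have hrE : r ∈ E := (hUE hr).resolve_left hrF
    refine ⟨C, hC, fun A hA hAH => hmax A hA (hAH.trans hHD), ?_, fun S hSH => ?_⟩
    · refine (Set.ncard_le_ncard fun x hx => ?_).trans h1
      exact ⟨⟨key x hx.1.1 (hsl.mem_of_reachIn (hx.2.mono hH) hrE), hx.1.2⟩, hx.2.mono hHD⟩
    · refine (Set.ncard_le_ncard fun x hx => ?_).trans (h2 S (hSH.trans hHD))
      exact ⟨⟨key x hx.1.1 (hsl.mem_of_reachIn (hx.2.mono (hSH.trans hH)) hrE), hx.1.2⟩, hx.2⟩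

end

/-! ### Removing light components -/

section
variable {j : ℕ} {top : Set V → V} {T : Set V → Set V} {D H H₀ U₀ : Set V} {a : V}

theorem IsHullSystem.hullClosed_hull (hT : IsHullSystem G j top T) {A : Set V}
    (hA : StronglyConn G A) : HullClosed G T (T A) := fun _ hB hBA => hT.hull_mono hA hB hBA

theorem IsHullSystem.hullClosed_diff (hT : IsHullSystem G j top T) {A : Set V}
    (hA : StronglyConn G A) : HullClosed G T (T A \ {top A}) := fun B hB hBA v hv =>
  ⟨hT.hull_mono hA hB (hBA.trans Set.sdiff_subset) hv, fun h => by
    rw [Set.mem_singleton_iff] at h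
    exact hT.top_notMem_hull hA hB hBA (h ▸ hv)⟩

theorem outNbr_diff_singleton_subset (P : Set V) (z : V) :
    outNbr G (P \ {z}) ⊆ insert z (outNbr G P) := by
  rintro x ⟨hx, u, hu, hux⟩
  by_cases hxz : x = z
  · exact .inl hxz
  · exact .inr ⟨fun h => hx ⟨h, hxz⟩, u, hu.1, hux⟩

theorem IsHullSystem.card_outNbr_diff [Finite V] (hT : IsHullSystem G j top T) {A : Set V}
    (hA : StronglyConn G A) : (outNbr G (T A \ {top A})).ncard ≤ j + 1 :=
  (Set.ncard_le_ncard (outNbr_diff_singleton_subset _ _)).trans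
    ((Set.ncard_insert_le _ _).trans (Nat.succ_le_succ (hT.card_outNbr hA)))

theorem card_outNbr_inter_le [Finite V] {U : Set V} (hU : U ⊆ U₀) (Q : Set V) :
    (outNbr G U ∩ Q).ncard ≤ (outNbr G U₀ ∩ Q).ncard + (outNbr G U ∩ U₀ ∩ Q).ncard := by
  refine (Set.ncard_le_ncard fun x hx => ?_).trans (Set.ncard_union_le _ _)
  by_cases hx0 : x ∈ U₀
  · exact .inr ⟨⟨hx.1, hx0⟩, hx.2⟩
  · obtain ⟨u, hu, hux⟩ := hx.1.2
    exact .inl ⟨⟨hx0, u, hU hu, hux⟩, hx.2⟩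

/-- An intermediate situation of a stage: the robber territory `U` lies in `P ∪ E`, where `P` is
hull-closed and, as `a ∈ D \ P`, smaller than `D`. The vertices of `outNbr G U ∩ U₀` are those
occupied during the stage; none of them lies in `E`. -/
structure Filling (G : Digraph V) (j : ℕ) (T : Set V → Set V) (D U₀ : Set V) (a : V)
    (P H E U : Set V) : Prop where
  closed : HullClosed G T P
  notMem : a ∉ P
  subset_hull : P ⊆ H
  hull_subset : H ⊆ D
  card_hull : (outNbr G H).ncard ≤ j
  card_outNbr : (outNbr G P).ncard ≤ 2 * j + 2
  card_border : (outNbr G P ∩ (E ∪ Dᶜ)).ncard ≤ j + 1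
  territory : U ⊆ P ∪ E
  subset : U ⊆ U₀
  rooted : ∃ r, Rooted G r U
  clean : ∀ x ∈ outNbr G U, x ∈ U₀ → x ∉ E
  card_marks : (outNbr G U ∩ U₀ ∩ P).ncard ≤ 6 * j + 4
  balanced : ∀ Q, StronglyConn G Q → Q ⊆ P → (outNbr G U ∩ Q).ncard ≤ 10 * j + 6
  spread : Spread G (14 * j + 9) (outNbr G U ∩ P) H U

variable [Finite V]

/-- If the robber retreats into `F ∪ E` and few vertices of the component `F` border on its
territory, then the hull of `F` can replace `P`. -/
theorem Stage.winsFrom_of_subset_union (hS : Stage G j T D H U₀) (hT : IsHullSystem G j top T)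
    {F E : Set V} (hsl : IsSlice G D F E) (ha : a ∉ F ∪ E)
    (hFill : ∀ P H U, Filling G j T D U₀ a P H E U →
      WinsFrom G (18 * (j + 1) ^ 2 + 3 * (j + 1)) U)
    {U : Set V} {r : V} (hr : Rooted G r U) (hUE : U ⊆ F ∪ E) (hU : U ⊆ U₀)
    (hclean : ∀ x ∈ outNbr G U, x ∈ U₀ → x ∉ E) (hF : (outNbr G U ∩ F).ncard ≤ 10 * j + 6)
    (hM : (outNbr G U ∩ U₀ ∩ F).ncard ≤ 6 * j + 4) :
    WinsFrom G (18 * (j + 1) ^ 2 + 3 * (j + 1)) U := by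
  have hFc := hsl.scc.conn
  have hTF : T F ⊆ F ∪ E :=
    hsl.hull_subset_union hT hS.closed hFc Set.subset_union_left
  have hTD : T F ⊆ D := hTF.trans hsl.union_subset
  have hcard := hT.card_outNbr hFc
  refine hFill (T F) (T F) U ?_
  exact
    { closed := hT.hullClosed_hull hFc
      notMem := fun h => ha (hTF h)
      subset_hull := subset_rfl
      hull_subset := hTD
      card_hull := hcard
      card_outNbr := by omega
      card_border := (Set.ncard_le_ncard Set.inter_subset_left).trans (by omega)
      territory := hUE.trans (Set.union_subset_union_left E (hT.subset_hull hFc))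
      subset := hU
      rooted := ⟨r, hr⟩
      clean := hclean
      card_marks := by
        refine (Set.ncard_le_ncard fun x hx => ?_).trans hM
        exact ⟨hx.1, (hTF hx.2).resolve_right (hclean x hx.1.1 hx.1.2)⟩
      balanced := fun Q hQ hQF => by
        rcases hsl.subset_or_subset hQ (hQF.trans hTF) with h | h
        · exact (Set.ncard_le_ncard (Set.inter_subset_inter_right _ h)).trans hF
        · refine (Set.ncard_le_ncard fun x hx => ?_).trans
            (hS.balanced Q hQ (h.trans hsl.subset))
          obtain ⟨u, hu, hux⟩ := hx.1.2
          exact ⟨⟨fun h0 => hclean x hx.1 h0 (h hx.2), u, hU hu, hux⟩, hx.2⟩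
      spread := hS.spread_of_subset hsl hUE hU hclean (hF.trans (by omega)) hTD }

/-! ### Heavy components and pockets -/

/-- A strongly connected part `L` of `F` that borders on `U₀` in many vertices, and is maximal
among the strongly connected subsets of `F` with the same top vertex. -/
structure IsHeavyNode (G : Digraph V) (j : ℕ) (top : Set V → V) (F U₀ L : Set V) : Prop where
  conn : StronglyConn G L
  subset : L ⊆ F
  eq_of_top_eq : ∀ K, StronglyConn G K → L ⊆ K → K ⊆ F → top K = top L → K = L
  heavy : 6 * j + 3 < (outNbr G U₀ ∩ L).ncard

/-- Below the top vertex of a heavy node there is at most one heavy node `L'`. -/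
theorem IsHeavyNode.exists_child (hT : IsHullSystem G j top T) {F L : Set V}
    (hF : (outNbr G U₀ ∩ F).ncard ≤ 10 * j + 6) (hL : IsHeavyNode G j top F U₀ L) :
    ∃ L', (L' = ∅ ∨ IsHeavyNode G j top F U₀ L') ∧ L' ⊆ L \ {top L} ∧
      ∀ Q, StronglyConn G Q → Q ⊆ L \ {top L} →
        Q ⊆ L' ∨ (outNbr G U₀ ∩ Q).ncard ≤ 6 * j + 3 := by
  by_cases hex : ∃ r ∈ L \ {top L}, 6 * j + 3 < (outNbr G U₀ ∩ sccOf G (L \ {top L}) r).ncard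
  · obtain ⟨r, hr, hheavy⟩ := hex
    have hscc := isScc_sccOf (G := G) hr
    set L' := sccOf G (L \ {top L}) r with hL'
    have hL'L : L' ⊆ L := hscc.subset.trans Set.sdiff_subset
    refine ⟨L', .inr ⟨hscc.conn, hL'L.trans hL.subset, ?_, hheavy⟩, hscc.subset, ?_⟩
    · intro K hK hLK hKF htop
      have hKL : (K ∩ L).Nonempty := hscc.conn.1.mono (Set.subset_inter hLK hL'L)
      have hu := hK.union hL.conn hKL
      have htL : top K ∈ L := htop ▸ hL'L (hT.top_mem hscc.conn)
      have h1 : top (K ∪ L) ∈ L := by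
        rcases hT.top_mem hu with h | h
        · rwa [hT.top_eq hK hu Set.subset_union_left h]
        · exact h
      have h2 := hT.top_eq hL.conn hu Set.subset_union_right h1
      have h3 := hL.eq_of_top_eq _ hu Set.subset_union_right (Set.union_subset hKF hL.subset) h2
      have hKL : K ⊆ L := h3 ▸ Set.subset_union_left
      refine (hscc.max K hK (fun x hx => ⟨hKL hx, fun hxt => ?_⟩) ?_).antisymm hLK
      · rw [Set.mem_singleton_iff] at hxt
        have h4 := hT.top_eq hK hL.conn hKL (hxt ▸ hx)
        have h5 := hscc.subset (hT.top_mem hscc.conn)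
        exact h5.2 (by rw [← htop, ← h4]; rfl)
      · exact hscc.conn.1.mono (Set.subset_inter hLK subset_rfl)
    · intro Q hQ hQL
      rcases hscc.subset_or_disjoint hQ hQL with h | h
      · exact .inl h
      · right
        have h1 : (outNbr G U₀ ∩ Q ∪ outNbr G U₀ ∩ L').ncard ≤ (outNbr G U₀ ∩ F).ncard := by
          refine Set.ncard_le_ncard ?_
          rw [← Set.inter_union_distrib_left]
          exact Set.inter_subset_inter_right _ (Set.union_subset
            ((hQL.trans Set.sdiff_subset).trans hL.subset) (hL'L.trans hL.subset))
        rw [Set.ncard_union_eq (h.mono Set.inter_subset_right Set.inter_subset_right)] at h1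
        omega
  · push Not at hex
    refine ⟨∅, .inl rfl, Set.empty_subset _, fun Q hQ hQL => .inr ?_⟩
    obtain ⟨r, hr⟩ := hQ.1
    exact (Set.ncard_le_ncard (Set.inter_subset_inter_right _
      (hQ.subset_sccOf hQL hr (mem_sccOf (hQL hr))))).trans (hex r (hQL hr))

/-- The static part of the situation reached while a heavy component `F` of `E` is removed: next to
`P`, the robber may use the hull of a heavy node `L` of `F`. The set `J` bounds the part of `F` that
`P` can still use, and `N₀` contains the out-neighbours of `P` that matter. -/
structure IsPocket (G : Digraph V) (j : ℕ) (T : Set V → Set V) (D : Set V) (a : V)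
    (F E H N₀ P J L : Set V) : Prop where
  closed : HullClosed G T P
  notMem : a ∉ P
  subset_hull : P ⊆ H
  border : outNbr G P ∩ (E ∪ Dᶜ) ⊆ N₀
  border_inter : outNbr G P ∩ F ∩ J ⊆ N₀
  card_outNbr : (outNbr G P).ncard ≤ 2 * j + 2
  closed_J : HullClosed G T J
  card_J : (outNbr G J).ncard ≤ j + 1
  inter_subset_J : P ∩ F ⊆ J
  hull_subset_J : T L ⊆ J

/-- The robber territory `U` lies in the pocket given by `P`, `L` and `E`, and the vertices occupied
during the stage lie outside the part of the pocket in `F ∪ E`. -/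
structure InPocket (G : Digraph V) (j : ℕ) (T : Set V → Set V) (U₀ F E H P L U : Set V) :
    Prop where
  territory : U ⊆ P ∪ T L ∪ E
  subset : U ⊆ U₀
  rooted : ∃ r, Rooted G r U
  clean : ∀ x ∈ outNbr G U, x ∈ U₀ → x ∉ P ∩ (F ∪ E) ∪ T L ∪ E
  card_marks : (outNbr G U ∩ U₀ ∩ P).ncard ≤ 6 * j + 4
  balanced : ∀ Q, StronglyConn G Q → Q ⊆ P → (outNbr G U ∩ Q).ncard ≤ 10 * j + 6
  spread : Spread G (14 * j + 9) (outNbr G U ∩ P) H U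

/-- If the robber retreats into `F ∪ E` with no heavy node `L` bordering on its territory, the
remaining vertices of `F` bordering on it are few. -/
theorem Stage.winsFrom_of_disjoint_node (hS : Stage G j T D H₀ U₀) (hT : IsHullSystem G j top T)
    {F E L : Set V} (hsl : IsSlice G D F E) (ha : a ∉ F ∪ E)
    (hFill : ∀ P H U, Filling G j T D U₀ a P H E U →
      WinsFrom G (18 * (j + 1) ^ 2 + 3 * (j + 1)) U)
    (hL : IsHeavyNode G j top F U₀ L)
    {U : Set V} {r : V} (hr : Rooted G r U) (hUE : U ⊆ F ∪ E) (hU : U ⊆ U₀)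
    (hclean : ∀ x ∈ outNbr G U, x ∈ U₀ → x ∉ E) (hUL : ∀ x ∈ outNbr G U, x ∉ L)
    (hM : (outNbr G U ∩ U₀ ∩ F).ncard ≤ 6 * j + 4) :
    WinsFrom G (18 * (j + 1) ^ 2 + 3 * (j + 1)) U := by
  refine hS.winsFrom_of_subset_union hT hsl ha hFill hr hUE hU hclean ?_ hM
  have h1 : (outNbr G U₀ ∩ L ∪ (outNbr G U₀ ∩ F) \ L).ncard ≤ 10 * j + 6 :=
    (Set.ncard_le_ncard (Set.union_subset (Set.inter_subset_inter_right _ hL.subset)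
      Set.sdiff_subset)).trans (hS.balanced F hsl.scc.conn hsl.scc.subset)
  rw [Set.ncard_union_eq (Set.disjoint_left.2 fun x hx hx' => hx'.2 hx.2)] at h1
  have h2 := hL.heavy
  have h3 : outNbr G U ∩ F ⊆ (outNbr G U₀ ∩ F) \ L ∪ outNbr G U ∩ U₀ ∩ F := by
    rintro x ⟨hx, hxF⟩
    by_cases hx0 : x ∈ U₀
    · exact .inr ⟨⟨hx, hx0⟩, hxF⟩
    · obtain ⟨u, hu, hux⟩ := hx.2
      exact .inl ⟨⟨⟨hx0, u, hU hu, hux⟩, hxF⟩, hUL x hx⟩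
  have h4 := (Set.ncard_le_ncard h3).trans (Set.ncard_union_le _ _)
  omega

/-- The robber has left the pocket towards `F`, but can still reach `L` inside `Y`, and is in the
component `K` of `L` there. The cops occupy the out-neighbours of the hull of `K`, and the top
vertex of `K`. Either the robber loses contact with `L`, or `K` shrinks, or the robber is confined
to the hull of `L`, or to a smaller pocket. -/
theorem Stage.winsFrom_of_mem_component (hS : Stage G j T D H₀ U₀) (hT : IsHullSystem G j top T)
    {F E : Set V} (hsl : IsSlice G D F E) (ha : a ∉ F ∪ E)
    (hFill : ∀ P H U, Filling G j T D U₀ a P H E U →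
      WinsFrom G (18 * (j + 1) ^ 2 + 3 * (j + 1)) U)
    {N₀ P J L L' M : Set V} (hN₀ : N₀.ncard ≤ j + 1) (hHD : H ⊆ D)
    (hP : IsPocket G j T D a F E H N₀ P J L) (hL : IsHeavyNode G j top F U₀ L)
    (hL' : L' = ∅ ∨ IsHeavyNode G j top F U₀ L') (hL'L : L' ⊆ L \ {top L})
    (hlight : ∀ Q, StronglyConn G Q → Q ⊆ L \ {top L} →
      Q ⊆ L' ∨ (outNbr G U₀ ∩ Q).ncard ≤ 6 * j + 3)
    (hNext : ∀ P J U, IsPocket G j T D a F E H N₀ P J L' → InPocket G j T U₀ F E H P L' U →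
      WinsFrom G (18 * (j + 1) ^ 2 + 3 * (j + 1)) U)
    (hM : M.ncard ≤ 4 * j + 2) (hLM : outNbr G (T L) ⊆ M) (n : ℕ) :
    ∀ {Y K B U : Set V} {r : V}, K.ncard ≤ n → Y ⊆ P ∪ T L ∪ E → Y ⊆ F ∪ E → T L ⊆ Y →
      IsScc G Y K → L ⊆ K → r ∈ K → Rooted G r U → U ⊆ Y → U ⊆ U₀ →
      (∀ x ∈ U, x ∉ outNbr G (P ∪ T L' ∪ E)) → (∀ x ∈ outNbr G U, x ∈ U₀ → x ∉ E) →
      (∀ x ∈ outNbr G U, x ∈ U₀ → x ∈ F → x ∈ M ∪ B) →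
      (∀ x ∈ outNbr G U, x ∈ U₀ → x ∈ F → x ∈ P ∪ T L' ∪ E → x ∈ B) →
      B.ncard ≤ j + 1 → Disjoint B (T K) →
      WinsFrom G (18 * (j + 1) ^ 2 + 3 * (j + 1)) U := by
  induction n with
  | zero =>
    intro Y K B U r hn _ _ _ _ _ hrK
    have := (Set.ncard_eq_zero (s := K)).1 (Nat.le_zero.1 hn)
    simp [this] at hrK
  | succ n ih =>
  intro Y K B U r hn hYR hYE hLY hscc hLK hrK hr hUY hU hesc hclean hmF hmR hB hBK
  have hK := hscc.conn
  have hFE : ∀ x ∈ F, x ∉ E := fun _ hx => Set.disjoint_left.1 hsl.disj hx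
  have hYD : Y ⊆ D := hYE.trans hsl.union_subset
  have hKF : K ⊆ F := hsl.scc.max K hK (hscc.subset.trans hYD)
    (hL.conn.1.mono (Set.subset_inter hLK hL.subset))
  have hzK : top K ∈ K := hT.top_mem hK
  set z := top K with hz
  have hKT : K ⊆ T K := hT.subset_hull hK
  have hNK := hT.card_outNbr hK
  have hcard5 : (M ∪ B ∪ insert z (outNbr G (T K))).ncard ≤ 6 * j + 4 := by
    have h1 := Set.ncard_union_le (M ∪ B) (insert z (outNbr G (T K)))
    have h2 := Set.ncard_union_le M B
    have h3 := Set.ncard_insert_le z (outNbr G (T K))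
    omega
  refine hS.winsFrom_of_place (W := (outNbr G (T K) ∩ F ∪ {z}) ∩ U) hU hr
    Set.inter_subset_right ?_ ?_
  · refine ((Set.ncard_le_ncard ?_).trans hcard5).trans (by omega)
    rintro x (⟨hx, hx0⟩ | ⟨hx | hx, -⟩)
    · obtain ⟨u, hu, hux⟩ := hx.2
      have := hsl.closed_union u (hYE (hUY hu)) x (hS.subset hx0) hux
      exact .inl (hmF x hx hx0 (this.resolve_right (hclean x hx hx0)))
    · exact .inr (.inr hx.1)
    · exact .inr (.inl hx)
  intro r₁ U₁ hr₁ hU₁U hdisj hN₁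
  have hU₁Y := hU₁U.trans hUY
  have hU₁0 := hU₁U.trans hU
  have hUW : ∀ x ∈ U₁, x ∈ F → x ∉ outNbr G (T K) := fun x hx hxF hxN =>
    Set.disjoint_left.1 hdisj hx ⟨.inl ⟨hxN, hxF⟩, hU₁U hx⟩
  have hzU₁ : z ∉ U₁ := fun hx => Set.disjoint_left.1 hdisj hx ⟨.inr rfl, hU₁U hx⟩
  have hclean₁ : ∀ x ∈ outNbr G U₁, x ∈ U₀ → x ∉ E := by
    intro x hx hx0
    rcases hN₁ hx with h | ⟨h | h, -⟩
    · exact hclean x h hx0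
    · exact hFE x h.2
    · exact hFE x (h ▸ hKF hzK)
  have hm₁ : (outNbr G U₁ ∩ U₀ ∩ F).ncard ≤ 6 * j + 4 := by
    refine (Set.ncard_le_ncard ?_).trans hcard5
    rintro x ⟨⟨hx, hx0⟩, hxF⟩
    rcases hN₁ hx with h | ⟨h | h, -⟩
    · exact .inl (hmF x h hx0 hxF)
    · exact .inr (.inr h.1)
    · exact .inr (.inl h)
  -- if `r₁` does not reach `L` inside some superset of `U₁ ∪ L`, then `L` does not border on `U₁`
  have hexit : ∀ Y', U₁ ⊆ Y' → L ⊆ Y' → (¬ ∃ l ∈ L, ReachIn G Y' r₁ l) →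
      WinsFrom G (18 * (j + 1) ^ 2 + 3 * (j + 1)) U₁ := by
    intro Y' hUY' hLY' hno
    refine hS.winsFrom_of_disjoint_node hT hsl ha hFill hL hr₁ (hU₁Y.trans hYE) hU₁0 hclean₁
      (fun x hx hxL => hno ⟨x, hxL, ?_⟩) hm₁
    exact (hr₁.extend hx).mono (Set.insert_subset (hLY' hxL) hUY')
  have hLTL : L ⊆ T L := hT.subset_hull hL.conn
  by_cases hreach : ∃ l ∈ L, ReachIn G Y r₁ l
  swap
  · exact hexit Y hU₁Y (hLTL.trans hLY) hreach
  have hr₁K : r₁ ∈ K := by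
    obtain ⟨l, hl, hrl⟩ := hreach
    exact hscc.mem hrK (hLK hl) ((hr.2 r₁ (hU₁U hr₁.1)).mono hUY) hrl
  have hU₁K : U₁ ⊆ T K ∪ E := by
    intro v hv
    refine (hr₁.2 v hv).mem_of_closed (.inl (hKT hr₁K)) ?_
    rintro x ⟨-, hx⟩ y hy hxy
    rcases hx with hx | hx
    · by_contra hyK
      have hyF := (hYE (hU₁Y hy)).resolve_right fun h => hyK (.inr h)
      exact hUW y hy hyF ⟨fun h => hyK (.inl h), x, hx, hxy⟩
    · exact .inr (hsl.closed x hx y (hYD (hU₁Y hy)) hxy)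
  have hpred : ∀ x ∈ outNbr G U₁, x ∈ F → x ∈ T K ∨ x ∈ outNbr G (T K) := by
    intro x hx hxF
    obtain ⟨u, hu, hux⟩ := hx.2
    by_cases hxK : x ∈ T K
    · exact .inl hxK
    · rcases hU₁K hu with h | h
      · exact .inr ⟨hxK, u, h, hux⟩
      · exact absurd (hsl.closed u h x (hsl.scc.subset hxF) hux) (hFE x hxF)
  have hmF₁ : ∀ x ∈ outNbr G U₁, x ∈ U₀ → x ∈ F → x ∈ M ∪ insert z (outNbr G (T K)) := by
    intro x hx hx0 hxF
    rcases hpred x hx hxF with hxK | hxK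
    · rcases hN₁ hx with h | ⟨h | h, -⟩
      · rcases hmF x h hx0 hxF with h | h
        · exact .inl h
        · exact absurd hxK (Set.disjoint_left.1 hBK h)
      · exact .inr (.inr h.1)
      · exact .inr (.inl h)
    · exact .inr (.inr hxK)
  have hmR₁ : ∀ x ∈ outNbr G U₁, x ∈ U₀ → x ∈ F → x ∈ P ∪ T L' ∪ E →
      x ∈ insert z (outNbr G (T K)) := by
    intro x hx hx0 hxF hxR
    rcases hpred x hx hxF with hxK | hxK
    · rcases hN₁ hx with h | ⟨h | h, -⟩
      · exact absurd hxK (Set.disjoint_left.1 hBK (hmR x h hx0 hxF hxR))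
      · exact .inr h.1
      · exact .inl h
    · exact .inr hxK
  have hTLK : T L ⊆ T K := hT.hull_mono hK hL.conn (hLK.trans hKT)
  have hTLE : T L ⊆ F ∪ E := hLY.trans hYE
  have hL'F : L' ⊆ F := (hL'L.trans Set.sdiff_subset).trans hL.subset
  by_cases hzL : z ∈ T L
  · -- the robber is confined to the hull of `L`
    have htop : top K = top L := by_contra fun h => hT.top_notMem hL.conn hK hLK h hzL
    have hKL : K = L := hL.eq_of_top_eq K hK hLK hKF htop
    subst hKL
    have hsub : T K \ {z} ⊆ T K := Set.sdiff_subset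
    have hTKD : T K ⊆ D := hLY.trans hYD
    have hNF : (outNbr G U₁ ∩ U₀ ∩ F).ncard ≤ 4 * j + 3 := by
      refine (Set.ncard_le_ncard ?_).trans ((Set.ncard_insert_le z M).trans (by omega))
      rintro x ⟨⟨hx, hx0⟩, hxF⟩
      rcases hmF₁ x hx hx0 hxF with h | h | h
      · exact .inr h
      · exact .inl h
      · exact .inr (hLM h)
    refine hFill (T K \ {z}) (T K) U₁ ?_
    exact
      { closed := hT.hullClosed_diff hK
        notMem := fun h => ha (hTLE h.1)
        subset_hull := hsub
        hull_subset := hTKD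
        card_hull := hNK
        card_outNbr := (hT.card_outNbr_diff hK).trans (by omega)
        card_border := (Set.ncard_le_ncard Set.inter_subset_left).trans (hT.card_outNbr_diff hK)
        territory := fun v hv => (hU₁K hv).imp_left fun h => ⟨h, fun hvz =>
          hzU₁ (Set.mem_singleton_iff.1 hvz ▸ hv)⟩
        subset := hU₁0
        rooted := ⟨r₁, hr₁⟩
        clean := hclean₁
        card_marks := by
          refine (Set.ncard_le_ncard fun x hx => ?_).trans hm₁
          exact ⟨hx.1, (hTLE (hsub hx.2)).resolve_right (hclean₁ x hx.1.1 hx.1.2)⟩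
        balanced := fun Q hQ hQT => by
          have hQFE := (hQT.trans hsub).trans hTLE
          have hQ0 := hS.balanced Q hQ (hQFE.trans hsl.union_subset)
          have h1 := card_outNbr_inter_le (G := G) hU₁0 Q
          have hcase : (outNbr G U₁ ∩ U₀ ∩ Q) = ∅ →
              (outNbr G U₁ ∩ Q).ncard ≤ 10 * j + 6 := fun h => by
            rw [h, Set.ncard_empty] at h1; omega
          rcases hsl.subset_or_subset hQ hQFE with hQF | hQE
          swap
          · exact hcase (Set.eq_empty_of_forall_notMem fun x hx =>
              hclean₁ x hx.1.1 hx.1.2 (hQE hx.2))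
          have hmQ : (outNbr G U₁ ∩ U₀ ∩ Q).ncard ≤ 4 * j + 2 := by
            refine (Set.ncard_le_ncard ?_).trans hM
            rintro x ⟨⟨hx, hx0⟩, hxQ⟩
            rcases hmF₁ x hx hx0 (hQF hxQ) with h | h | h
            · exact h
            · exact absurd h (hQT hxQ).2
            · exact hLM h
          by_cases hQK : (Q ∩ K).Nonempty
          · have hu := hQ.union hK hQK
            have htu : top (Q ∪ K) = top K := by
              by_contra hne
              refine hT.top_notMem hK hu Set.subset_union_right hne ?_
              exact (Set.union_subset (hQT.trans hsub) hKT) (hT.top_mem hu)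
            have hQL : Q ⊆ K := (hL.eq_of_top_eq _ hu Set.subset_union_right
              (Set.union_subset hQF hKF) htu) ▸ Set.subset_union_left
            rcases hlight Q hQ fun x hx => ⟨hQL hx, (hQT hx).2⟩ with h | h
            · refine hcase (Set.eq_empty_of_forall_notMem ?_)
              rintro x ⟨⟨hx, hx0⟩, hxQ⟩
              have hL'c : StronglyConn G L' := by
                rcases hL' with h' | h'
                · rw [h'] at h
                  exact absurd (h hxQ) (Set.notMem_empty x)
                · exact h'.conn
              rcases hmR₁ x hx hx0 (hQF hxQ) (.inl (.inr (hT.subset_hull hL'c (h hxQ))))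
                with h' | h'
              · exact (hQT hxQ).2 h'
              · exact h'.1 (hQT hxQ).1
            · omega
          · have h2 : (outNbr G U₀ ∩ K ∪ outNbr G U₀ ∩ Q).ncard ≤ 10 * j + 6 := by
              refine (Set.ncard_le_ncard ?_).trans (hS.balanced F hsl.scc.conn hsl.scc.subset)
              rw [← Set.inter_union_distrib_left]
              exact Set.inter_subset_inter_right _ (Set.union_subset hKF hQF)
            rw [Set.ncard_union_eq (Set.disjoint_left.2 fun x hx hx' =>
              hQK ⟨x, hx'.2, hx.2⟩)] at h2
            have h3 := hL.heavy
            omega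
        spread := by
          refine hS.spread_of_subset hsl (hU₁Y.trans hYE) hU₁0 hclean₁ ?_ hTKD
          have h1 := card_outNbr_inter_le (G := G) hU₁0 F
          have h2 := hS.balanced F hsl.scc.conn hsl.scc.subset
          omega }
  have hzP : z ∈ P := by
    rcases hYR (hscc.subset hzK) with (h | h) | h
    · exact h
    · exact absurd h hzL
    · exact absurd h (hFE z (hKF hzK))
  set Y₃ := (Y ∩ (T K ∪ E)) \ {z} with hY₃
  have hY₃Y : Y₃ ⊆ Y := Set.sdiff_subset.trans Set.inter_subset_left
  have hU₁Y₃ : U₁ ⊆ Y₃ := fun v hv => ⟨⟨hU₁Y hv, hU₁K hv⟩, fun h =>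
    hzU₁ (Set.mem_singleton_iff.1 h ▸ hv)⟩
  have hTLY₃ : T L ⊆ Y₃ := fun v hv => ⟨⟨hLY hv, .inl (hTLK hv)⟩, fun h =>
    hzL (Set.mem_singleton_iff.1 h ▸ hv)⟩
  have hLY₃ := hLTL.trans hTLY₃
  by_cases hreach₃ : ∃ l ∈ L, ReachIn G Y₃ r₁ l
  swap
  · exact hexit Y₃ hU₁Y₃ hLY₃ hreach₃
  obtain ⟨l, hl, hrl⟩ := hreach₃
  have hcardB : (insert z (outNbr G (T K))).ncard ≤ j + 1 :=
    (Set.ncard_insert_le _ _).trans (Nat.succ_le_succ hNK)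
  by_cases hback : ∃ l' ∈ L, ReachIn G Y₃ l' r₁
  · -- the component of `L` shrinks
    obtain ⟨l', hl', hlr⟩ := hback
    have hscc₃ := isScc_sccOf (G := G) (hU₁Y₃ hr₁.1)
    set K' := sccOf G Y₃ r₁ with hK'
    have hLK' : L ⊆ K' := by
      refine hscc₃.max L hL.conn hLY₃ ⟨l, hl, hrl, ?_⟩
      exact ((hL.conn.2 l hl l' hl').mono hLY₃).trans hlr
    have hK'K : K' ⊆ K := hscc.max K' hscc₃.conn (hscc₃.subset.trans hY₃Y)
      (hL.conn.1.mono (Set.subset_inter hLK' hLK))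
    have hzK' : z ∉ K' := fun h => (hscc₃.subset h).2 rfl
    have hK'H : K' ⊆ T K \ {top K} := fun v hv => ⟨hKT (hK'K hv), by
      rintro rfl
      exact hzK' hv⟩
    have hlt : K'.ncard < K.ncard := Set.ncard_lt_ncard ⟨hK'K, fun h => hzK' (h hzK)⟩
    refine ih (K := K') (B := insert z (outNbr G (T K))) (by omega) (hY₃Y.trans hYR)
      (hY₃Y.trans hYE) hTLY₃ hscc₃ hLK' (mem_sccOf (hU₁Y₃ hr₁.1)) hr₁ hU₁Y₃ hU₁0
      (fun x hx => hesc x (hU₁U hx)) hclean₁ hmF₁ hmR₁ hcardB ?_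
    rw [Set.disjoint_left]
    rintro x (hx | hx) hxK'
    · subst hx
      exact hT.top_notMem_hull hK hscc₃.conn hK'H hxK'
    · exact hx.1 (hT.hull_mono hK hscc₃.conn (hK'H.trans Set.sdiff_subset) hxK')
  -- the robber is confined to a smaller pocket
  have hr₁F := hKF hr₁K
  have hr₁P : r₁ ∈ P := by
    rcases hYR (hscc.subset hr₁K) with (h | h) | h
    · exact h
    · obtain ⟨l', hl', hlr⟩ := hT.reachIn hL.conn r₁ h
      exact absurd ⟨l', hl', hlr.mono hTLY₃⟩ hback
    · exact absurd h (hFE r₁ hr₁F)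
  have hU₁R : U₁ ⊆ P ∪ T L' ∪ E := by
    intro v hv
    refine (hr₁.2 v hv).mem_of_closed (.inl (.inl hr₁P)) ?_
    rintro x ⟨-, hx⟩ y hy hxy
    by_contra hyR
    exact hesc y (hU₁U hy) ⟨hyR, x, hx, hxy⟩
  have hL'H : L' = ∅ ∨ (StronglyConn G L' ∧ L' ⊆ T K \ {z}) := by
    refine hL'.imp_right fun h => ⟨h.conn, fun v hv => ?_⟩
    have hvL := (hL'L hv).1
    exact ⟨hKT (hLK hvL), fun hvz => hzL (hLTL (Set.mem_singleton_iff.1 hvz ▸ hvL))⟩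
  have hTL'H : T L' ⊆ T K \ {z} := by
    rcases hL'H with h | h
    · rw [h, hT.hull_empty]; exact Set.empty_subset _
    · exact hT.hullClosed_diff hK L' h.1 h.2
  have hKJ : K ⊆ J := fun v hv => by
    rcases hYR (hscc.subset hv) with (h | h) | h
    · exact hP.inter_subset_J ⟨h, hKF hv⟩
    · exact hP.hull_subset_J h
    · exact absurd h (hFE v (hKF hv))
  have hTKJ : T K ⊆ J := hP.closed_J K hK hKJ
  set P' := P ∩ (E ∪ (F ∩ (T K \ {z}))) with hP'
  have hP'P : P' ⊆ P := Set.inter_subset_left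
  have hPD : P ⊆ D := hP.subset_hull.trans hHD
  have hbor : outNbr G P' ∩ (E ∪ Dᶜ) ⊆ N₀ := by
    rintro x ⟨⟨hx, u, hu, hux⟩, hxE⟩
    refine hP.border ⟨⟨fun hxP => ?_, u, hu.1, hux⟩, hxE⟩
    rcases hxE with h | h
    · exact hx ⟨hxP, .inl h⟩
    · exact h (hPD hxP)
  have hborJ : outNbr G P' ∩ F ∩ (T K \ {z}) ⊆ N₀ := by
    rintro x ⟨⟨⟨hx, u, hu, hux⟩, hxF⟩, hxH⟩
    exact hP.border_inter ⟨⟨⟨fun hxP => hx ⟨hxP, .inr ⟨hxF, hxH⟩⟩, u, hu.1, hux⟩, hxF⟩,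
      hTKJ hxH.1⟩
  have hmarks : ∀ x ∈ outNbr G U₁, x ∈ U₀ → x ∉ P' ∩ (F ∪ E) ∪ T L' ∪ E := by
    intro x hx hx0 hxR
    have hxE := hclean₁ x hx hx0
    have hxH : x ∈ T K \ {z} := by
      rcases hxR with (h | h) | h
      · exact (h.1.2.resolve_left hxE).2
      · exact hTL'H h
      · exact absurd h hxE
    have hxF : x ∈ F := by
      rcases hxR with (h | h) | h
      · exact h.2.resolve_right hxE
      · refine (hsl.hull_subset_union hT hS.closed hK (hKF.trans Set.subset_union_left)
          hxH.1).resolve_right hxE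
      · exact absurd h hxE
    rcases hmR₁ x hx hx0 hxF (hxR.imp_left fun h => h.imp_left fun h => h.1.1) with h | h
    · exact hxH.2 h
    · exact h.1 hxH.1
  have hP'E : P' ⊆ F ∪ E := fun v hv => hv.2.elim .inr fun h => .inl h.1
  have hmP' : outNbr G U₁ ∩ U₀ ∩ P' = ∅ := Set.eq_empty_of_forall_notMem fun x hx =>
    hmarks x hx.1.1 hx.1.2 (.inl (.inl ⟨hx.2, hP'E hx.2⟩))
  have hP'0 : outNbr G U₁ ∩ P' ⊆ outNbr G U₀ ∩ D := by
    rintro x ⟨hx, hxP'⟩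
    obtain ⟨u, hu, hux⟩ := hx.2
    exact ⟨⟨fun h0 => hmarks x hx h0 (.inl (.inl ⟨hxP', hP'E hxP'⟩)), u, hU₁0 hu, hux⟩,
      hPD hxP'.1⟩
  refine hNext P' (T K \ {z}) U₁
    { closed := ?_
      notMem := fun h => hP.notMem h.1
      subset_hull := hP'P.trans hP.subset_hull
      border := hbor
      border_inter := hborJ
      card_outNbr := ?_
      closed_J := hT.hullClosed_diff hK
      card_J := hT.card_outNbr_diff hK
      inter_subset_J := ?_
      hull_subset_J := hTL'H }
    { territory := ?_
      subset := hU₁0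
      rooted := ⟨r₁, hr₁⟩
      clean := hmarks
      card_marks := by rw [hmP', Set.ncard_empty]; omega
      balanced := ?_
      spread := hS.spread.mono hP'0 (hHD.trans hS.subset_hull) hU₁0 }
  · intro A hA hAP v hv
    refine ⟨hP.closed A hA (hAP.trans hP'P) hv, ?_⟩
    rcases hsl.subset_or_subset hA (hAP.trans hP'E) with hAF | hAE
    · have h1 : A ⊆ T K \ {z} := fun x hx =>
        ((hAP hx).2.resolve_left (hFE x (hAF hx))).2
      have h2 := hT.hullClosed_diff hK A hA h1 hv
      exact (hsl.hull_subset_union hT hS.closed hA (hAP.trans hP'E) hv).elim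
        (fun h => .inr ⟨h, h2⟩) .inl
    · exact .inl (hsl.hull_subset hT hS.closed hA hAE hv)
  · refine (Set.ncard_le_ncard (t := N₀ ∪ outNbr G (T K \ {z})) ?_).trans
      ((Set.ncard_union_le _ _).trans ?_)
    · intro x hx
      obtain ⟨hxP', u, hu, hux⟩ := id hx
      by_cases hxD : x ∈ D
      · rcases hsl.closed_union u (hP'E hu) x hxD hux with hxF | hxE
        · by_cases hxH : x ∈ T K \ {z}
          · exact .inl (hborJ ⟨⟨hx, hxF⟩, hxH⟩)
          · rcases hu.2 with h | h
            · exact absurd (hsl.closed u h x hxD hux) (hFE x hxF)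
            · exact .inr ⟨hxH, u, h.2, hux⟩
        · exact .inl (hbor ⟨hx, .inl hxE⟩)
      · exact .inl (hbor ⟨hx, .inr hxD⟩)
    · have : (outNbr G (T K \ {z})).ncard ≤ j + 1 := hT.card_outNbr_diff hK
      omega
  · rintro v ⟨hv, hvF⟩
    exact (hv.2.resolve_left (hFE v hvF)).2
  · intro v hv
    rcases hU₁R hv with (h | h) | h
    · left; left
      refine ⟨h, ?_⟩
      by_cases hvE : v ∈ E
      · exact .inl hvE
      · exact .inr ⟨(hYE (hU₁Y hv)).resolve_right hvE,
          (hU₁K hv).resolve_right hvE, (hU₁Y₃ hv).2⟩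
    · exact .inl (.inr h)
    · exact .inr h
  · intro Q hQ hQP'
    refine (Set.ncard_le_ncard fun x hx => ?_).trans
      (hS.balanced Q hQ (hQP'.trans (hP'P.trans hPD)))
    exact ⟨(hP'0 ⟨hx.1, hQP' hx.2⟩).1, hx.2⟩

/-- The cops win from a pocket: they occupy the vertices through which the robber could leave the
pocket of the next smaller heavy node `L'`. -/
theorem Stage.winsFrom_of_inPocket (hS : Stage G j T D H₀ U₀) (hT : IsHullSystem G j top T)
    {F E : Set V} (hsl : IsSlice G D F E) (ha : a ∉ F ∪ E)
    (hFill : ∀ P H U, Filling G j T D U₀ a P H E U →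
      WinsFrom G (18 * (j + 1) ^ 2 + 3 * (j + 1)) U)
    {N₀ : Set V} (hN₀ : N₀.ncard ≤ j + 1) (hHD : H ⊆ D) (hH : (outNbr G H).ncard ≤ j) (n : ℕ) :
    ∀ {L P J U : Set V}, L.ncard ≤ n → (L = ∅ ∨ IsHeavyNode G j top F U₀ L) →
      IsPocket G j T D a F E H N₀ P J L → InPocket G j T U₀ F E H P L U →
      WinsFrom G (18 * (j + 1) ^ 2 + 3 * (j + 1)) U := by
  -- without a heavy node, the territory is `P` and the components still to be removed
  have hempty : ∀ P J U, IsPocket G j T D a F E H N₀ P J ∅ → InPocket G j T U₀ F E H P ∅ U →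
      WinsFrom G (18 * (j + 1) ^ 2 + 3 * (j + 1)) U := fun P J U hP hU => hFill P H U
    { closed := hP.closed
      notMem := hP.notMem
      subset_hull := hP.subset_hull
      hull_subset := hHD
      card_hull := hH
      card_outNbr := hP.card_outNbr
      card_border := (Set.ncard_le_ncard hP.border).trans hN₀
      territory := by simpa [hT.hull_empty] using hU.territory
      subset := hU.subset
      rooted := hU.rooted
      clean := fun x hx hx0 hxE => hU.clean x hx hx0 (.inr hxE)
      card_marks := hU.card_marks
      balanced := hU.balanced
      spread := hU.spread }
  induction n with
  | zero =>
    intro L P J U hn _ hP hU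
    obtain rfl := (Set.ncard_eq_zero (s := L)).1 (Nat.le_zero.1 hn)
    exact hempty P J U hP hU
  | succ n ih =>
  intro L P J U hn hL hP hU
  rcases hL with rfl | hL
  · exact hempty P J U hP hU
  have hFbal := hS.balanced F hsl.scc.conn hsl.scc.subset
  obtain ⟨L', hL', hL'L, hlight⟩ := hL.exists_child hT hFbal
  have hL'lt : L'.ncard < L.ncard :=
    Set.ncard_lt_ncard ⟨hL'L.trans Set.sdiff_subset, fun h => (hL'L (h (hT.top_mem hL.conn))).2 rfl⟩
  have hLTL : L ⊆ T L := hT.subset_hull hL.conn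
  have hTL' : T L' ⊆ T L := by
    rcases hL' with h | h
    · rw [h, hT.hull_empty]; exact Set.empty_subset _
    · exact hT.hull_mono hL.conn h.conn ((hL'L.trans Set.sdiff_subset).trans hLTL)
  have hNL' : (outNbr G (T L')).ncard ≤ j := by
    rcases hL' with h | h
    · have : outNbr G (T L') = ∅ := by
        rw [h, hT.hull_empty]
        exact Set.eq_empty_of_forall_notMem fun x ⟨_, u, hu, _⟩ => hu
      simp [this]
    · exact hT.card_outNbr h.conn
  have hNL := hT.card_outNbr hL.conn
  have hFE : ∀ x ∈ F, x ∉ E := fun _ hx => Set.disjoint_left.1 hsl.disj hx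
  have hTLE : T L ⊆ F ∪ E := hsl.hull_subset_union hT hS.closed hL.conn
    (hL.subset.trans Set.subset_union_left)
  have hTLD := hTLE.trans hsl.union_subset
  have hNext : ∀ P J U, IsPocket G j T D a F E H N₀ P J L' → InPocket G j T U₀ F E H P L' U →
      WinsFrom G (18 * (j + 1) ^ 2 + 3 * (j + 1)) U := fun P J U => ih (by omega) hL'
  obtain ⟨r, hr⟩ := hU.rooted
  set R := P ∪ T L' ∪ E with hR
  -- the vertices through which the robber can leave the smaller pocket
  have hW : U ∩ outNbr G R ⊆ N₀ ∪ outNbr G (T L') := by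
    rintro x ⟨hx, hxR, u, hu, hux⟩
    have hxL : x ∈ T L := by
      rcases hU.territory hx with (h | h) | h
      · exact absurd (.inl (.inl h)) hxR
      · exact h
      · exact absurd (.inr h) hxR
    have hxF : x ∈ F := (hTLE hxL).resolve_right fun h => hxR (.inr h)
    rcases hu with (hu | hu) | hu
    · exact .inl (hP.border_inter ⟨⟨⟨fun h => hxR (.inl (.inl h)), u, hu, hux⟩, hxF⟩,
        hP.hull_subset_J hxL⟩)
    · exact .inr ⟨fun h => hxR (.inl (.inr h)), u, hu, hux⟩
    · exact absurd (hsl.closed u hu x (hTLD hxL) hux) fun h => hxR (.inr h)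
  refine hS.winsFrom_of_place (W := U ∩ outNbr G R) hU.subset hr Set.inter_subset_left ?_ ?_
  · have h1 : outNbr G U ∩ U₀ ∪ U ∩ outNbr G R ⊆ (outNbr G U ∩ U₀ ∩ P) ∪ outNbr G P ∪
        outNbr G (T L) ∪ (N₀ ∪ outNbr G (T L')) := by
      rintro x (⟨hx, hx0⟩ | hx)
      · left
        by_cases hxP : x ∈ P
        · exact .inl (.inl ⟨⟨hx, hx0⟩, hxP⟩)
        obtain ⟨u, hu, hux⟩ := hx.2
        rcases hU.territory hu with (h | h) | h
        · exact .inl (.inr ⟨hxP, u, h, hux⟩)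
        · exact .inr ⟨fun hxL => hU.clean x hx hx0 (.inl (.inr hxL)), u, h, hux⟩
        · exact absurd (.inr (hsl.closed u h x (hS.subset hx0) hux)) (hU.clean x hx hx0)
      · exact .inr (hW hx)
    have h2 := Set.ncard_le_ncard h1
    have h3 := Set.ncard_union_le ((outNbr G U ∩ U₀ ∩ P) ∪ outNbr G P ∪ outNbr G (T L))
      (N₀ ∪ outNbr G (T L'))
    have h4 := Set.ncard_union_le ((outNbr G U ∩ U₀ ∩ P) ∪ outNbr G P) (outNbr G (T L))
    have h5 := Set.ncard_union_le (outNbr G U ∩ U₀ ∩ P) (outNbr G P)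
    have h6 := Set.ncard_union_le N₀ (outNbr G (T L'))
    have h7 := hP.card_outNbr
    have h8 := hU.card_marks
    omega
  intro r₁ U₁ hr₁ hU₁U hdisj hN₁
  have hU₁0 := hU₁U.trans hU.subset
  have hesc : ∀ x ∈ U₁, x ∉ outNbr G R := fun x hx hxR =>
    Set.disjoint_left.1 hdisj hx ⟨hU₁U hx, hxR⟩
  have hNR : ∀ x ∈ outNbr G U₁, x ∈ R → x ∈ outNbr G U := fun x hx hxR =>
    (hN₁ hx).resolve_right fun h => h.2.1 hxR
  have hPR : P ⊆ R := fun x hx => .inl (.inl hx)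
  by_cases hr₁R : r₁ ∈ R
  · -- the robber is confined to the smaller pocket
    have hNP : outNbr G U₁ ∩ P ⊆ outNbr G U ∩ P := fun x hx => ⟨hNR x hx.1 (hPR hx.2), hx.2⟩
    refine hNext P J U₁
      { closed := hP.closed
        notMem := hP.notMem
        subset_hull := hP.subset_hull
        border := hP.border
        border_inter := hP.border_inter
        card_outNbr := hP.card_outNbr
        closed_J := hP.closed_J
        card_J := hP.card_J
        inter_subset_J := hP.inter_subset_J
        hull_subset_J := hTL'.trans hP.hull_subset_J }
      { territory := ?_
        subset := hU₁0
        rooted := ⟨r₁, hr₁⟩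
        clean := ?_
        card_marks := (Set.ncard_le_ncard fun x hx => by
          exact ⟨⟨(hNP ⟨hx.1.1, hx.2⟩).1, hx.1.2⟩, hx.2⟩).trans hU.card_marks
        balanced := fun Q hQ hQP => (Set.ncard_le_ncard fun x hx => by
          exact ⟨(hNP ⟨hx.1, hQP hx.2⟩).1, hx.2⟩).trans (hU.balanced Q hQ hQP)
        spread := hU.spread.mono hNP subset_rfl hU₁U }
    · intro v hv
      refine (hr₁.2 v hv).mem_of_closed hr₁R ?_
      rintro x ⟨-, hx⟩ y hy hxy
      by_contra hyR
      exact hesc y hy ⟨hyR, x, hx, hxy⟩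
    · intro x hx hx0 hxR
      have hxR' : x ∈ R := by
        rcases hxR with (h | h) | h
        · exact hPR h.1
        · exact .inl (.inr h)
        · exact .inr h
      refine hU.clean x (hNR x hx hxR') hx0 ?_
      exact hxR.imp_left fun h => h.imp_right fun h => hTL' h
  -- otherwise the robber is in `F`, outside the smaller pocket
  have hr₁L : r₁ ∈ T L := by
    rcases hU.territory (hU₁U hr₁.1) with (h | h) | h
    · exact absurd (hPR h) hr₁R
    · exact h
    · exact absurd (.inr h) hr₁R
  have hU₁E : U₁ ⊆ F ∪ E := fun v hv =>
    hsl.mem_union_of_reachIn ((hr₁.2 v hv).mono (hU₁0.trans hS.subset)) (hTLE hr₁L)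
  have hclean₁ : ∀ x ∈ outNbr G U₁, x ∈ U₀ → x ∉ E := fun x hx hx0 hxE =>
    hU.clean x (hNR x hx (.inr hxE)) hx0 (.inr hxE)
  set M := N₀ ∪ outNbr G J ∪ outNbr G (T L) ∪ outNbr G (T L') with hM
  have hMcard : M.ncard ≤ 4 * j + 2 := by
    have h1 := Set.ncard_union_le (N₀ ∪ outNbr G J ∪ outNbr G (T L)) (outNbr G (T L'))
    have h2 := Set.ncard_union_le (N₀ ∪ outNbr G J) (outNbr G (T L))
    have h3 := Set.ncard_union_le N₀ (outNbr G J)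
    have h4 := hP.card_J
    rw [hM]
    omega
  have hmF : ∀ x ∈ outNbr G U₁, x ∈ U₀ → x ∈ F → x ∈ M := by
    intro x hx hx0 hxF
    rcases hN₁ hx with h | h
    · have hcl := hU.clean x h hx0
      obtain ⟨u, hu, hux⟩ := hx.2
      have hxP : x ∉ P := fun hxP => hcl (.inl (.inl ⟨hxP, .inl hxF⟩))
      rcases hU.territory (hU₁U hu) with (h | h) | h
      · have huF : u ∈ F := (hU₁E hu).resolve_right fun huE =>
          hFE x hxF (hsl.closed u huE x (hS.subset hx0) hux)
        by_cases hxJ : x ∈ J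
        · exact .inl (.inl (.inl (hP.border_inter ⟨⟨⟨hxP, u, h, hux⟩, hxF⟩, hxJ⟩)))
        · exact .inl (.inl (.inr ⟨hxJ, u, hP.inter_subset_J ⟨h, huF⟩, hux⟩))
      · exact .inl (.inr ⟨fun hxL => hcl (.inl (.inr hxL)), u, h, hux⟩)
      · exact absurd (hsl.closed u h x (hS.subset hx0) hux) (hFE x hxF)
    · exact (hW h).elim (fun h => .inl (.inl (.inl h))) .inr
  have hmR : ∀ x ∈ outNbr G U₁, x ∈ U₀ → x ∈ F → x ∈ P ∪ T L' ∪ E → x ∈ (∅ : Set V) := by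
    intro x hx hx0 hxF hxR
    refine hU.clean x (hNR x hx hxR) hx0 ?_
    rcases hxR with (h | h) | h
    · exact .inl (.inl ⟨h, .inl hxF⟩)
    · exact .inl (.inr (hTL' h))
    · exact .inr h
  set Y := (P ∪ T L ∪ E) ∩ (F ∪ E) with hY
  have hU₁Y : U₁ ⊆ Y := fun v hv => ⟨hU.territory (hU₁U hv), hU₁E hv⟩
  have hLY : T L ⊆ Y := fun v hv => ⟨.inl (.inr hv), hTLE hv⟩
  by_cases hreach : ∃ l ∈ L, ReachIn G Y r₁ l
  · obtain ⟨l, hl, hrl⟩ := hreach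
    obtain ⟨l', hl', hlr⟩ := hT.reachIn hL.conn r₁ hr₁L
    have hscc := isScc_sccOf (G := G) (hU₁Y hr₁.1)
    refine hS.winsFrom_of_mem_component hT hsl ha hFill hN₀ hHD hP hL hL' hL'L hlight hNext
      hMcard (fun x hx => .inl (.inr hx)) _ le_rfl Set.inter_subset_left Set.inter_subset_right
      hLY hscc ?_ (mem_sccOf (hU₁Y hr₁.1)) hr₁ hU₁Y hU₁0 hesc hclean₁ (B := ∅)
      (fun x hx hx0 hxF => .inl (hmF x hx hx0 hxF)) hmR (by simp) (Set.empty_disjoint _)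
    refine hscc.max L hL.conn (hLTL.trans hLY) ⟨l, hl, hrl, ?_⟩
    exact ((hL.conn.2 l hl l' hl').mono (hLTL.trans hLY)).trans (hlr.mono hLY)
  · refine hS.winsFrom_of_disjoint_node hT hsl ha hFill hL hr₁ hU₁E hU₁0 hclean₁
      (fun x hx hxL => hreach ⟨x, hxL, ?_⟩) ?_
    · exact (hr₁.extend hx).mono (Set.insert_subset (hLY (hLTL hxL)) hU₁Y)
    · refine ((Set.ncard_le_ncard fun x hx => ?_).trans hMcard).trans (by omega)
      exact hmF x hx.1.1 hx.1.2 hx.2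

/-! ### Filling a stage -/

/-- A nonempty set `E ⊆ D` that no edge of `D` leaves contains a component of `D` that no edge
of `E` enters. -/
theorem exists_isSlice {E : Set V} (hED : E ⊆ D) (hE : E.Nonempty)
    (hcl : ∀ x ∈ E, ∀ y ∈ D, G.Adj x y → y ∈ E) :
    ∃ F E', IsSlice G D F E' ∧ F ∪ E' = E := by
  obtain ⟨v, hv, hmax⟩ := E.toFinite.exists_maximalFor (fun v => (reachSet G D v).ncard) E hE
  have hclR : ∀ x y, ReachIn G D x y → x ∈ E → y ∈ E := fun x y h hx =>
    h.mem_of_closed hx fun u hu w hw => hcl u hu.2 w hw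
  set F := sccOf G D v with hF
  have hFE : F ⊆ E := fun w hw => hclR v w hw.1 hv
  have hun : F ∪ E \ F = E := Set.union_sdiff_cancel hFE
  refine ⟨F, E \ F, ⟨isScc_sccOf (hED hv), Set.sdiff_subset.trans hED, Set.disjoint_sdiff_right,
    ?_, by rwa [hun]⟩, hun⟩
  rintro x ⟨hx, hxF⟩ y hy hxy
  refine ⟨hcl x hx y hy hxy, fun hyF => hxF ?_⟩
  have hxv : ReachIn G D x v := ((ReachIn.refl (hED hx)).tail hxy hy).trans hyF.2
  have hsub : reachSet G D v ⊆ reachSet G D x := fun w hw => hxv.trans hw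
  have heq : reachSet G D v = reachSet G D x :=
    Set.eq_of_subset_of_ncard_le hsub (hmax hx (Set.ncard_le_ncard hsub))
  have hxx : x ∈ reachSet G D x := ReachIn.refl (hED hx)
  rw [← heq] at hxx
  exact ⟨hxx, hxv⟩

/-- The cops win from an intermediate situation, if they win from every stage on a smaller set:
the components making up `E` are taken from the robber one after another. -/
theorem Stage.winsFrom_of_filling (hS : Stage G j T D H₀ U₀) (hT : IsHullSystem G j top T)
    (haD : a ∈ D)
    (hRest : ∀ D' H' U', D'.ncard < D.ncard → Stage G j T D' H' U' →
      WinsFrom G (18 * (j + 1) ^ 2 + 3 * (j + 1)) U') (n : ℕ) :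
    ∀ {E P H U : Set V}, E.ncard ≤ n → E ⊆ D → a ∉ E →
      (∀ x ∈ E, ∀ y ∈ D, G.Adj x y → y ∈ E) → Filling G j T D U₀ a P H E U →
      WinsFrom G (18 * (j + 1) ^ 2 + 3 * (j + 1)) U := by
  have hempty : ∀ P H U, Filling G j T D U₀ a P H ∅ U →
      WinsFrom G (18 * (j + 1) ^ 2 + 3 * (j + 1)) U := fun P H U hU =>
    hRest P H U (Set.ncard_lt_ncard ⟨hU.subset_hull.trans hU.hull_subset, fun h =>
      hU.notMem (h haD)⟩)
      { closed := hU.closed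
        subset_hull := hU.subset_hull
        card_outNbr := hU.card_outNbr
        card_hull := hU.card_hull
        subset := by simpa using hU.territory
        rooted := hU.rooted
        balanced := hU.balanced
        spread := hU.spread }
  induction n with
  | zero =>
    intro E P H U hn _ _ _ hU
    obtain rfl := (Set.ncard_eq_zero (s := E)).1 (Nat.le_zero.1 hn)
    exact hempty P H U hU
  | succ n ih =>
  intro E₁ P H U hn hED ha hcl hU
  rcases E₁.eq_empty_or_nonempty with rfl | hne
  · exact hempty P H U hU
  obtain ⟨F, E, hsl, rfl⟩ := exists_isSlice hED hne hcl
  have hlt : E.ncard < (F ∪ E).ncard := by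
    refine Set.ncard_lt_ncard ⟨Set.subset_union_right, fun h => ?_⟩
    obtain ⟨x, hx⟩ := hsl.scc.conn.1
    exact Set.disjoint_left.1 hsl.disj hx (h (.inl hx))
  have hFE : ∀ x ∈ F, x ∉ E := fun _ hx => Set.disjoint_left.1 hsl.disj hx
  have hFill : ∀ P H U, Filling G j T D U₀ a P H E U →
      WinsFrom G (18 * (j + 1) ^ 2 + 3 * (j + 1)) U := fun P H U =>
    ih (by omega) hsl.subset (fun h => ha (.inr h)) hsl.closed
  obtain ⟨r, hr⟩ := hU.rooted
  by_cases hheavy : 6 * j + 3 < (outNbr G U₀ ∩ F).ncard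
  · -- `F` itself is a heavy node
    have hTF : T F ⊆ F ∪ E :=
      hsl.hull_subset_union hT hS.closed hsl.scc.conn Set.subset_union_left
    refine hS.winsFrom_of_inPocket hT hsl ha hFill (N₀ := outNbr G P ∩ (F ∪ E ∪ Dᶜ))
      hU.card_border hU.hull_subset hU.card_hull _ (L := F) (P := P) (J := Set.univ) le_rfl
      (.inr ⟨hsl.scc.conn, subset_rfl, fun K _ hFK hKF _ => hKF.antisymm hFK, hheavy⟩)
      { closed := hU.closed
        notMem := hU.notMem
        subset_hull := hU.subset_hull
        border := fun x hx => ⟨hx.1, hx.2.imp_left .inr⟩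
        border_inter := fun x hx => ⟨hx.1.1, .inl (.inl hx.1.2)⟩
        card_outNbr := hU.card_outNbr
        closed_J := fun A _ _ => Set.subset_univ _
        card_J := ?_
        inter_subset_J := Set.subset_univ _
        hull_subset_J := Set.subset_univ _ }
      { territory := ?_
        subset := hU.subset
        rooted := hU.rooted
        clean := ?_
        card_marks := hU.card_marks
        balanced := hU.balanced
        spread := hU.spread }
    · have : outNbr G (Set.univ : Set V) = ∅ :=
        Set.eq_empty_of_forall_notMem fun x hx => hx.1 trivial
      simp [this]
    · intro v hv
      rcases hU.territory hv with h | h | h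
      · exact .inl (.inl h)
      · exact .inl (.inr (hT.subset_hull hsl.scc.conn h))
      · exact .inr h
    · rintro x hx hx0 ((h | h) | h)
      · exact hU.clean x hx hx0 h.2
      · exact hU.clean x hx hx0 (hTF h)
      · exact hU.clean x hx hx0 (.inr h)
  -- the cops block the passage from `P ∪ E` to `F`
  have hW : U ∩ outNbr G (P ∪ E) ⊆ F ∩ (outNbr G P ∩ (F ∪ E ∪ Dᶜ)) := by
    rintro x ⟨hx, hxP, u, hu, hux⟩
    have hxF : x ∈ F := by
      rcases hU.territory hx with h | h | h
      · exact absurd (.inl h) hxP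
      · exact h
      · exact absurd (.inr h) hxP
    refine ⟨hxF, ⟨fun h => hxP (.inl h), u, ?_, hux⟩, .inl (.inl hxF)⟩
    exact hu.resolve_right fun h =>
      hFE x hxF (hsl.closed u h x (hsl.scc.subset hxF) hux)
  have hWcard : (F ∩ (outNbr G P ∩ (F ∪ E ∪ Dᶜ))).ncard ≤ j + 1 :=
    (Set.ncard_le_ncard Set.inter_subset_right).trans hU.card_border
  refine hS.winsFrom_of_place (W := U ∩ outNbr G (P ∪ E)) hU.subset hr Set.inter_subset_left ?_ ?_
  · have h1 : outNbr G U ∩ U₀ ∪ U ∩ outNbr G (P ∪ E) ⊆ (outNbr G U ∩ U₀ ∩ P) ∪ outNbr G P ∪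
        F ∩ (outNbr G P ∩ (F ∪ E ∪ Dᶜ)) := by
      rintro x (⟨hx, hx0⟩ | hx)
      · left
        by_cases hxP : x ∈ P
        · exact .inl ⟨⟨hx, hx0⟩, hxP⟩
        obtain ⟨u, hu, hux⟩ := hx.2
        rcases hU.territory hu with h | h
        · exact .inr ⟨hxP, u, h, hux⟩
        · exact absurd (hcl u h x (hS.subset hx0) hux) (hU.clean x hx hx0)
      · exact .inr (hW hx)
    have h2 := Set.ncard_le_ncard h1
    have h3 := Set.ncard_union_le ((outNbr G U ∩ U₀ ∩ P) ∪ outNbr G P)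
      (F ∩ (outNbr G P ∩ (F ∪ E ∪ Dᶜ)))
    have h5 := Set.ncard_union_le (outNbr G U ∩ U₀ ∩ P) (outNbr G P)
    have h7 := hU.card_outNbr
    have h8 := hU.card_marks
    omega
  intro r₁ U₁ hr₁ hU₁U hdisj hN₁
  have hU₁0 := hU₁U.trans hU.subset
  have hclean₁ : ∀ x ∈ outNbr G U₁, x ∈ U₀ → x ∉ E := by
    intro x hx hx0 hxE
    rcases hN₁ hx with h | h
    · exact hU.clean x h hx0 (.inr hxE)
    · exact hFE x (hW h).1 hxE
  by_cases hr₁P : r₁ ∈ P ∪ E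
  · have hNP : outNbr G U₁ ∩ P ⊆ outNbr G U ∩ P := fun x hx =>
      ⟨(hN₁ hx.1).resolve_right fun h => h.2.1 (.inl hx.2), hx.2⟩
    refine hFill P H U₁
      { closed := hU.closed
        notMem := hU.notMem
        subset_hull := hU.subset_hull
        hull_subset := hU.hull_subset
        card_hull := hU.card_hull
        card_outNbr := hU.card_outNbr
        card_border := (Set.ncard_le_ncard fun x hx => by
          exact ⟨hx.1, hx.2.imp_left .inr⟩).trans hU.card_border
        territory := ?_
        subset := hU₁0
        rooted := ⟨r₁, hr₁⟩
        clean := hclean₁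
        card_marks := (Set.ncard_le_ncard fun x hx => by
          exact ⟨⟨(hNP ⟨hx.1.1, hx.2⟩).1, hx.1.2⟩, hx.2⟩).trans hU.card_marks
        balanced := fun Q hQ hQP => (Set.ncard_le_ncard fun x hx => by
          exact ⟨(hNP ⟨hx.1, hQP hx.2⟩).1, hx.2⟩).trans (hU.balanced Q hQ hQP)
        spread := hU.spread.mono hNP subset_rfl hU₁U }
    intro v hv
    refine (hr₁.2 v hv).mem_of_closed hr₁P ?_
    rintro x ⟨-, hx⟩ y hy hxy
    by_contra hyP
    exact Set.disjoint_left.1 hdisj hy ⟨hU₁U hy, hyP, x, hx, hxy⟩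
  · have hr₁F : r₁ ∈ F ∪ E :=
      (hU.territory (hU₁U hr₁.1)).resolve_left fun h => hr₁P (.inl h)
    have hU₁E : U₁ ⊆ F ∪ E := fun v hv =>
      hsl.mem_union_of_reachIn ((hr₁.2 v hv).mono (hU₁0.trans hS.subset)) hr₁F
    have hM : (outNbr G U₁ ∩ U₀ ∩ F).ncard ≤ j + 1 := by
      refine (Set.ncard_le_ncard fun x hx => ?_).trans hWcard
      exact (hN₁ hx.1.1).elim (fun h => absurd (.inl hx.2) (hU.clean x h hx.1.2)) fun h => hW h
    have h1 := card_outNbr_inter_le (G := G) hU₁0 F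
    exact hS.winsFrom_of_subset_union hT hsl ha hFill hr₁ hU₁E hU₁0 hclean₁ (by omega) (by omega)

/-- The cops win from every stage: they occupy the top vertex of the component of `D` from which the
robber territory is rooted; the rest of that component is covered by a smaller hull. -/
theorem Stage.winsFrom (hT : IsHullSystem G j top T) (n : ℕ) :
    ∀ {D H U₀ : Set V}, D.ncard ≤ n → Stage G j T D H U₀ →
      WinsFrom G (18 * (j + 1) ^ 2 + 3 * (j + 1)) U₀ := by
  induction n with
  | zero =>
    intro D H U₀ hn hS
    obtain rfl := (Set.ncard_eq_zero (s := D)).1 (Nat.le_zero.1 hn)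
    obtain ⟨r, hr⟩ := hS.rooted
    exact absurd (hS.subset hr.1) (Set.notMem_empty r)
  | succ n ih =>
  intro D H U₀ hn hS
  obtain ⟨r, hr⟩ := hS.rooted
  have hrD := hS.subset hr.1
  have hscc := isScc_sccOf (G := G) hrD
  set A := sccOf G D r with hA
  have hAc := hscc.conn
  have haA := hT.top_mem hAc
  set a := top A with ha
  have hTD : T A ⊆ D := hS.closed A hAc hscc.subset
  have hHT : T A \ {a} ⊆ T A := Set.sdiff_subset
  refine hS.winsFrom_of_place (W := {a} ∩ U₀) subset_rfl hr Set.inter_subset_right ?_ ?_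
  · refine (Set.ncard_le_ncard (t := {a}) ?_).trans (by rw [Set.ncard_singleton]; omega)
    rintro x (⟨hx, hx0⟩ | hx)
    · exact absurd hx0 hx.1
    · exact hx.1
  intro r₁ U₁ hr₁ hU₁U hdisj hN₁
  have hNP : outNbr G U₁ ∩ (T A \ {a}) ⊆ outNbr G U₀ ∩ D := fun x hx =>
    ⟨(hN₁ hx.1).resolve_right fun h => hx.2.2 h.1, hTD hx.2.1⟩
  have hcl : ∀ x ∈ reachSet G D r \ A, ∀ y ∈ D, G.Adj x y → y ∈ reachSet G D r \ A := by
    rintro x ⟨hx, hxA⟩ y hy hxy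
    exact ⟨ReachIn.tail hx hxy hy, fun hyA => hxA ⟨hx,
      ((ReachIn.refl hx.right_mem).tail hxy hy).trans hyA.2⟩⟩
  refine hS.winsFrom_of_filling hT (hscc.subset haA)
    (fun D' H' U' hlt hS' => ih (by omega) hS') _ (E := reachSet G D r \ A) le_rfl
    (Set.sdiff_subset.trans reachSet_subset) (fun h => h.2 haA) hcl
    (P := T A \ {a}) (H := T A)
    { closed := hT.hullClosed_diff hAc
      notMem := fun h => h.2 rfl
      subset_hull := hHT
      hull_subset := hTD
      card_hull := hT.card_outNbr hAc
      card_outNbr := (hT.card_outNbr_diff hAc).trans (by omega)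
      card_border := (Set.ncard_le_ncard Set.inter_subset_left).trans (hT.card_outNbr_diff hAc)
      territory := ?_
      subset := hU₁U
      rooted := ⟨r₁, hr₁⟩
      clean := ?_
      card_marks := ?_
      balanced := fun Q hQ hQP => (Set.ncard_le_ncard fun x hx => by
        exact ⟨(hNP ⟨hx.1, hQP hx.2⟩).1, hx.2⟩).trans (hS.balanced Q hQ (hQP.trans (hHT.trans hTD)))
      spread := hS.spread.mono hNP (hTD.trans hS.subset_hull) hU₁U }
  · intro v hv
    by_cases hvA : v ∈ A
    · refine .inl ⟨hT.subset_hull hAc hvA, fun hva => ?_⟩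
      exact Set.disjoint_left.1 hdisj hv ⟨hva, hU₁U hv⟩
    · exact .inr ⟨(hr.2 v (hU₁U hv)).mono hS.subset, hvA⟩
  · intro x hx hx0 hxE
    rcases hN₁ hx with h | h
    · exact h.1 hx0
    · exact hxE.2 (h.1 ▸ haA)
  · have : outNbr G U₁ ∩ U₀ ∩ (T A \ {a}) = ∅ := Set.eq_empty_of_forall_notMem fun x hx =>
      (hNP ⟨hx.1.1, hx.2⟩).1.1 hx.1.2
    rw [this, Set.ncard_empty]
    omega

/-- If the graph has a hull system of out-degree at most `j`, the cops win from the vertices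
reachable from any given vertex. -/
theorem IsHullSystem.winsFrom (hT : IsHullSystem G j top T) (r : V) :
    WinsFrom G (18 * (j + 1) ^ 2 + 3 * (j + 1)) (reachSet G Set.univ r) := by
  have huniv : outNbr G (Set.univ : Set V) = ∅ :=
    Set.eq_empty_of_forall_notMem fun x hx => hx.1 trivial
  have hempty : outNbr G (reachSet G Set.univ r) = ∅ :=
    Set.subset_empty_iff.1 (huniv ▸ outNbr_reachSet)
  refine Stage.winsFrom hT _ (D := Set.univ) (H := Set.univ) le_rfl
    { closed := fun A _ _ => Set.subset_univ _
      subset_hull := subset_rfl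
      card_outNbr := by simp [huniv]
      card_hull := by simp [huniv]
      subset := Set.subset_univ _
      rooted := ⟨r, rooted_reachSet trivial⟩
      balanced := fun Q _ _ => by simp [hempty]
      spread := fun u _ => ⟨sccOf G Set.univ u, stronglyConn_sccOf trivial,
        fun A hA hAU hu => hA.subset_sccOf hAU hu (mem_sccOf trivial), by simp [hempty],
        fun S _ => by simp [hempty]⟩ }

end

/-! ### Hull systems from an order of the vertices -/

section
variable {j : ℕ} {ρ : V → ℕ} {S A B K T T' Z : Set V}

/-- The vertices of rank greater than all of `A` that have the greatest rank in some strongly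
connected set between `A` and `S`. A hull of `A` has to avoid them. -/
def blocked (G : Digraph V) (ρ : V → ℕ) (S A : Set V) : Set V :=
  {z | ∃ K, StronglyConn G K ∧ A ⊆ K ∧ K ⊆ S ∧ z ∈ K ∧ (∀ x ∈ K, ρ x ≤ ρ z) ∧ ∀ x ∈ A, ρ x < ρ z}

/-- There is an order on the vertices, given by an injective rank function, such that each strongly
connected `A ⊆ S` is contained in a set of out-degree at most `j` that avoids `Z` and the vertices
blocked for `A`. -/
def HasHullOrder (G : Digraph V) (j : ℕ) (S Z : Set V) : Prop :=
  ∃ ρ : V → ℕ, ρ.Injective ∧ ∀ A, StronglyConn G A → A ⊆ S →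
    ∃ T, A ⊆ T ∧ Disjoint T Z ∧ Disjoint T (blocked G ρ S A) ∧ (outNbr G T).ncard ≤ j

/-- `T` has the least out-degree among the supersets of `A` that avoid the vertices blocked for `A`,
and is smallest with this property. -/
structure IsHull (G : Digraph V) (ρ : V → ℕ) (A T : Set V) : Prop where
  subset : A ⊆ T
  disj : Disjoint T (blocked G ρ Set.univ A)
  card_le : ∀ X, A ⊆ X → Disjoint X (blocked G ρ Set.univ A) →
    (outNbr G T).ncard ≤ (outNbr G X).ncard
  ncard_le : ∀ X, A ⊆ X → Disjoint X (blocked G ρ Set.univ A) →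
    (outNbr G X).ncard ≤ (outNbr G T).ncard → T.ncard ≤ X.ncard

theorem HasHullOrder.mono {Z' : Set V} (h : HasHullOrder G j S Z') (hZ : Z ⊆ Z') :
    HasHullOrder G j S Z := by
  obtain ⟨ρ, hρ, h⟩ := h
  refine ⟨ρ, hρ, fun A hA hAS => ?_⟩
  obtain ⟨T, h1, h2, h3⟩ := h A hA hAS
  exact ⟨T, h1, h2.mono_right hZ, h3⟩

/-- If the greatest vertex `m` of a strongly connected `S ⊇ B` lies in a hull of `B`, then `m`
lies in `B`. -/
theorem IsHull.max_mem (hρ : ρ.Injective) (hT : IsHull G ρ B T) (hS : StronglyConn G S)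
    (hBS : B ⊆ S) {m : V} (hm : m ∈ S) (hmax : ∀ x ∈ S, ρ x ≤ ρ m) (hmT : m ∈ T) : m ∈ B := by
  by_contra hmB
  refine Set.disjoint_left.1 hT.disj hmT ⟨S, hS, hBS, Set.subset_univ _, hm, hmax, fun b hb => ?_⟩
  exact (hmax b (hBS hb)).lt_of_ne fun h => hmB (hρ h ▸ hb)

variable [Finite V]

theorem exists_isHull (hAT : A ⊆ T) (hT : Disjoint T (blocked G ρ Set.univ A)) :
    ∃ T', IsHull G ρ A T' := by
  obtain ⟨T₁, ⟨h1, h2⟩, h3⟩ := (Set.toFinite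
    {X | A ⊆ X ∧ Disjoint X (blocked G ρ Set.univ A)}).exists_minimalFor
    (fun X => (outNbr G X).ncard) _ ⟨T, hAT, hT⟩
  obtain ⟨T₂, ⟨h4, h5, h6⟩, h7⟩ := (Set.toFinite
    {X | A ⊆ X ∧ Disjoint X (blocked G ρ Set.univ A) ∧
      (outNbr G X).ncard ≤ (outNbr G T₁).ncard}).exists_minimalFor
    (fun X => X.ncard) _ ⟨T₁, h1, h2, le_rfl⟩
  have h8 : ∀ X, A ⊆ X → Disjoint X (blocked G ρ Set.univ A) →
      (outNbr G T₁).ncard ≤ (outNbr G X).ncard := fun X hX hX' =>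
    (le_total (outNbr G T₁).ncard (outNbr G X).ncard).elim id fun h => h3 ⟨hX, hX'⟩ h
  exact ⟨T₂, h4, h5, fun X hX hX' => h6.trans (h8 X hX hX'), fun X hX hX' h =>
    (le_total T₂.ncard X.ncard).elim id fun h' => h7 ⟨hX, hX', h.trans h6⟩ h'⟩

theorem card_outNbr_submodular (X Y : Set V) :
    (outNbr G (X ∪ Y)).ncard + (outNbr G (X ∩ Y)).ncard ≤
      (outNbr G X).ncard + (outNbr G Y).ncard := by
  rw [← Set.ncard_union_add_ncard_inter (outNbr G (X ∪ Y)),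
    ← Set.ncard_union_add_ncard_inter (outNbr G X)]
  refine Nat.add_le_add (Set.ncard_le_ncard ?_) (Set.ncard_le_ncard ?_)
  · rintro w (⟨hw, u, hu | hu, huw⟩ | ⟨hw, u, hu, huw⟩)
    · exact .inl ⟨fun h => hw (.inl h), u, hu, huw⟩
    · exact .inr ⟨fun h => hw (.inr h), u, hu, huw⟩
    · by_cases hwX : w ∈ X
      · exact .inr ⟨fun h => hw ⟨hwX, h⟩, u, hu.2, huw⟩
      · exact .inl ⟨hwX, u, hu.1, huw⟩
  · rintro w ⟨⟨hw, -⟩, -, u, hu, huw⟩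
    exact ⟨⟨fun h => hw (.inl h), u, hu.1, huw⟩, ⟨fun h => hw (.inr h), u, hu.2, huw⟩⟩

namespace IsHull

/-- A hull contains only vertices reachable from `A`, by minimality. -/
theorem reachIn (h : IsHull G ρ A T) : ∀ v ∈ T, ∃ u ∈ A, ReachIn G T u v := by
  set X := {v ∈ T | ∃ u ∈ A, ReachIn G T u v} with hX
  have hXT : X ⊆ T := fun _ hv => hv.1
  have hN : outNbr G X ⊆ outNbr G T := by
    rintro w ⟨hw, u, ⟨hu, a, ha, hau⟩, huw⟩
    exact ⟨fun hwT => hw ⟨hwT, a, ha, hau.tail huw hwT⟩, u, hu, huw⟩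
  have hle := h.ncard_le X (fun a ha => ⟨h.subset ha, a, ha, .refl (h.subset ha)⟩)
    (h.disj.mono_left hXT) (Set.ncard_le_ncard hN)
  have heq : X = T := Set.eq_of_subset_of_ncard_le hXT hle
  exact fun v hv => (heq.symm ▸ hv : v ∈ X).2

/-- Uncrossing two hulls. -/
theorem subset_of_disjoint (hT : IsHull G ρ A T) (hT' : IsHull G ρ B T') (hBT : B ⊆ T)
    (hdisj : Disjoint T' (blocked G ρ Set.univ A)) : T' ⊆ T := by
  have h1 := hT.card_le (T ∪ T') (hT.subset.trans Set.subset_union_left)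
    (Set.disjoint_union_left.2 ⟨hT.disj, hdisj⟩)
  have h2 := card_outNbr_submodular (G := G) T T'
  have h3 := hT'.ncard_le (T ∩ T') (Set.subset_inter hBT hT'.subset)
    (hT'.disj.mono_left Set.inter_subset_right) (by omega)
  exact Set.inter_eq_right.1 (Set.eq_of_subset_of_ncard_le Set.inter_subset_right h3)

theorem exists_max (hA : StronglyConn G A) : ∃ m ∈ A, ∀ x ∈ A, ρ x ≤ ρ m :=
  Set.exists_max_image A ρ A.toFinite hA.1

/-- The greatest vertex of a closed walk through `A`, `B` and a vertex `z` blocked for `A` would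
have to lie in one of the hulls, where it is blocked. -/
theorem disjoint_blocked (hρ : ρ.Injective) (hA : StronglyConn G A) (hB : StronglyConn G B)
    (hT : IsHull G ρ A T) (hT' : IsHull G ρ B T') (hBT : B ⊆ T) :
    Disjoint T' (blocked G ρ Set.univ A) := by
  rw [Set.disjoint_left]
  rintro z hz ⟨K, hK, hAK, -, hzK, hzmax, hzA⟩
  obtain ⟨b, hb, hbz⟩ := hT'.reachIn z hz
  obtain ⟨a, ha, hab⟩ := hT.reachIn b (hBT hb)
  set U := T' ∪ K ∪ T with hU
  have hT'U : T' ⊆ U := fun x hx => .inl (.inl hx)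
  have hKU : K ⊆ U := fun x hx => .inl (.inr hx)
  have hTU : T ⊆ U := fun x hx => .inr hx
  have h1 : ReachIn G U b z := hbz.mono hT'U
  have h2 : ReachIn G U z a := (hK.2 z hzK a (hAK ha)).mono hKU
  have h3 : ReachIn G U a b := hab.mono hTU
  set S := sccOf G U b with hS
  have hSc : StronglyConn G S := stronglyConn_sccOf h1.left_mem
  have hzS : z ∈ S := ⟨h1, h2.trans h3⟩
  have hAS : A ⊆ S := hA.subset_sccOf (hAK.trans hKU) ha ⟨h1.trans h2, h3⟩
  have hBS : B ⊆ S := hB.subset_sccOf (hT'.subset.trans hT'U) hb ⟨.refl h1.left_mem,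
    .refl h1.left_mem⟩
  obtain ⟨m, hm, hmax⟩ := exists_max (ρ := ρ) hSc
  have hmT : m ∉ T := fun h => Set.disjoint_left.1 hT.disj h
    ⟨S, hSc, hAS, Set.subset_univ _, hm, hmax, fun x hx => (hzA x hx).trans_le (hmax z hzS)⟩
  have hmT' : m ∉ T' := fun h => hmT (hBT (hT'.max_mem hρ hSc hBS hm hmax h))
  rcases sccOf_subset hm with (h | h) | h
  · exact hmT' h
  · exact hmT' (hρ ((hmax z hzS).antisymm (hzmax m h)) ▸ hz)
  · exact hmT h

theorem max_notMem (hρ : ρ.Injective) (hA : StronglyConn G A) (hB : StronglyConn G B)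
    (hT : IsHull G ρ A T) (hT' : IsHull G ρ B T') {c : V} (hc : c ∈ A) (hcmax : ∀ x ∈ A, ρ x ≤ ρ c)
    (hBT : B ⊆ T \ {c}) : c ∉ T' := by
  intro hcT'
  obtain ⟨b, hb, hbc⟩ := hT'.reachIn c hcT'
  obtain ⟨a, ha, hab⟩ := hT.reachIn b (hBT hb).1
  set U := T' ∪ T with hU
  have h1 : ReachIn G U b c := hbc.mono Set.subset_union_left
  have h2 : ReachIn G U c b := ((hA.2 c hc a ha).mono hT.subset |>.trans hab).mono
    Set.subset_union_right
  set S := sccOf G U b with hS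
  have hSc : StronglyConn G S := stronglyConn_sccOf h1.left_mem
  have hcS : c ∈ S := ⟨h1, h2⟩
  have hAS : A ⊆ S := hA.subset_sccOf (hT.subset.trans Set.subset_union_right) hc hcS
  have hBS : B ⊆ S := hB.subset_sccOf (hT'.subset.trans Set.subset_union_left) hb
    ⟨.refl h1.left_mem, .refl h1.left_mem⟩
  obtain ⟨m, hm, hmax⟩ := exists_max (ρ := ρ) hSc
  have hmT' : m ∈ T' → m ∈ B := hT'.max_mem hρ hSc hBS hm hmax
  have hmT : m ∈ T := (sccOf_subset hm).elim (fun h => (hBT (hmT' h)).1) id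
  have hmc : m = c := hρ (((hcmax m (hT.max_mem hρ hSc hAS hm hmax hmT))).antisymm (hmax c hcS))
  subst hmc
  exact (hBT (hmT' hcT')).2 rfl

end IsHull

/-- An order as above gives a hull system: the hulls of least out-degree. -/
theorem HasHullOrder.exists_isHullSystem [Nonempty V] (h : HasHullOrder G j Set.univ Z) :
    ∃ top T, IsHullSystem G j top T := by
  obtain ⟨ρ, hρ, hhull⟩ := h
  have hex : ∀ A, ∃ T, (StronglyConn G A → IsHull G ρ A T ∧ (outNbr G T).ncard ≤ j) ∧
      (¬ StronglyConn G A → T = ∅) := by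
    intro A
    by_cases hA : StronglyConn G A
    · obtain ⟨T, hAT, -, hdisj, hcard⟩ := hhull A hA (Set.subset_univ _)
      obtain ⟨T', hT'⟩ := exists_isHull hAT hdisj
      exact ⟨T', fun _ => ⟨hT', (hT'.card_le T hAT hdisj).trans hcard⟩, fun h => absurd hA h⟩
    · exact ⟨∅, fun h => absurd h hA, fun _ => rfl⟩
  choose T hT hT0 using hex
  have htop : ∀ A, ∃ c, StronglyConn G A → c ∈ A ∧ ∀ x ∈ A, ρ x ≤ ρ c := by
    intro A
    by_cases hA : StronglyConn G A
    · obtain ⟨m, hm⟩ := IsHull.exists_max (ρ := ρ) hA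
      exact ⟨m, fun _ => hm⟩
    · exact ⟨Classical.arbitrary V, fun h => absurd h hA⟩
  choose top htop using htop
  refine ⟨top, T,
    { top_mem := fun hA => (htop _ hA).1
      top_eq := ?_
      hull_empty := hT0 ∅ fun h => Set.not_nonempty_empty h.1
      subset_hull := fun hA => (hT _ hA).1.subset
      card_outNbr := fun hA => (hT _ hA).2
      reachIn := fun hA => (hT _ hA).1.reachIn
      top_notMem := ?_
      hull_mono := ?_
      top_notMem_hull := ?_ }⟩
  · intro A B hA hB hAB hBA
    exact hρ (((htop A hA).2 _ hBA).antisymm ((htop B hB).2 _ (hAB (htop A hA).1)))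
  · intro A K hA hK hAK hne hmem
    refine Set.disjoint_left.1 (hT A hA).1.disj hmem ⟨K, hK, hAK, Set.subset_univ _, (htop K hK).1,
      (htop K hK).2, fun x hx => ((htop A hA).2 x hx).trans_lt ?_⟩
    exact ((htop K hK).2 _ (hAK (htop A hA).1)).lt_of_ne fun h => hne (hρ h).symm
  · intro A B hA hB hBT
    exact (hT A hA).1.subset_of_disjoint (hT B hB).1 hBT
      (IsHull.disjoint_blocked hρ hA hB (hT A hA).1 (hT B hB).1 hBT)
  · intro A B hA hB hBT
    exact IsHull.max_notMem hρ hA hB (hT A hA).1 (hT B hB).1 (htop A hA).1 (htop A hA).2 hBT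

/-- Orders on the components of `S \ C` combine to an order on `S` in which the vertices of `C` come
last. For `A` meeting `C`, a subset of `X` serves as the hull. -/
theorem HasHullOrder.glue {C X : Set V} (hSX : S ⊆ X) (hXZ : Disjoint X Z)
    (hcard : (outNbr G X).ncard + (C ∩ S).ncard ≤ j + 1)
    (hC : ∀ r ∈ S \ C, HasHullOrder G j (sccOf G (S \ C) r) (Z ∪ C ∩ S)) :
    HasHullOrder G j S Z := by
  have hex : ∀ Q, ∃ ρ : V → ℕ, HasHullOrder G j Q (Z ∪ C ∩ S) → ρ.Injective ∧
      ∀ A, StronglyConn G A → A ⊆ Q → ∃ T, A ⊆ T ∧ Disjoint T (Z ∪ C ∩ S) ∧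
        Disjoint T (blocked G ρ Q A) ∧ (outNbr G T).ncard ≤ j := by
    intro Q
    by_cases h : HasHullOrder G j Q (Z ∪ C ∩ S)
    · exact h.imp fun ρ hρ _ => hρ
    · exact ⟨fun _ => 0, fun h' => absurd h' h⟩
  choose σ hσ using hex
  obtain ⟨N, ⟨e⟩⟩ := Finite.exists_equiv_fin V
  obtain ⟨M, hM⟩ := (Set.finite_range fun x => σ (sccOf G (S \ C) x) x).bddAbove
  replace hM : ∀ x, σ (sccOf G (S \ C) x) x ≤ M := fun x => hM ⟨x, rfl⟩
  classical
  -- ranks are compared lexicographically, which makes the combined rank function injective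
  set f : V → ℕ := fun x => if x ∈ C then M + 1 else σ (sccOf G (S \ C) x) x with hf
  set ρ : V → ℕ := fun x => f x * N + e x with hρ
  have hlex : ∀ x y, f x < f y → ρ x < ρ y := by
    intro x y h
    have h1 := Nat.mul_le_mul_right N h
    have h2 := (e x).2
    simp only [hρ]
    rw [Nat.succ_mul] at h1
    omega
  have hfC : ∀ x ∈ C, f x = M + 1 := fun x hx => if_pos hx
  have hfn : ∀ x, x ∉ C → f x ≤ M := fun x hx => by
    simp only [hf, if_neg hx]; exact hM x
  have hCn : ∀ x y, x ∈ C → y ∉ C → ρ y < ρ x := fun x y hx hy =>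
    hlex y x (by rw [hfC x hx]; exact Nat.lt_succ_of_le (hfn y hy))
  have hinj : ρ.Injective := by
    intro x y hxy
    rcases lt_trichotomy (f x) (f y) with h | h | h
    · exact absurd hxy (hlex x y h).ne
    · simp only [hρ, h] at hxy
      exact e.injective (Fin.ext (Nat.add_left_cancel hxy))
    · exact absurd hxy (hlex y x h).ne'
  refine ⟨ρ, hinj, fun A hA hAS => ?_⟩
  by_cases hAC : Disjoint A C
  · -- `A` lies in a component `Q` of `S \ C`
    obtain ⟨r, hr⟩ := hA.1
    have hAS' : A ⊆ S \ C := fun x hx => ⟨hAS hx, Set.disjoint_left.1 hAC hx⟩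
    have hQ := isScc_sccOf (G := G) (hAS' hr)
    set Q := sccOf G (S \ C) r with hQdef
    have hAQ : A ⊆ Q := hA.subset_sccOf hAS' hr (mem_sccOf (hAS' hr))
    obtain ⟨hinjQ, hhull⟩ := hσ Q (hC r (hAS' hr))
    have hfQ : ∀ x ∈ Q, f x = σ Q x := by
      intro x hx
      have hxS := hQ.subset hx
      have : sccOf G (S \ C) x = Q := by
        have hx' := isScc_sccOf (G := G) hxS
        exact (hQ.max _ hx'.conn hx'.subset ⟨x, mem_sccOf hxS, hx⟩).antisymm
          (hx'.max _ hQ.conn hQ.subset ⟨x, hx, mem_sccOf hxS⟩)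
      simp only [hf, if_neg hxS.2, this]
    obtain ⟨T, hAT, hTZ, hTb, hTc⟩ := hhull A hA hAQ
    refine ⟨T, hAT, hTZ.mono_right Set.subset_union_left, Set.disjoint_left.2 ?_, hTc⟩
    rintro z hzT ⟨K, hK, hAK, hKS, hzK, hzmax, hzA⟩
    by_cases hKC : Disjoint K C
    · have hKQ : K ⊆ Q := hQ.max K hK (fun x hx => ⟨hKS hx, Set.disjoint_left.1 hKC hx⟩)
        ⟨r, hAK hr, hAQ hr⟩
      have hle : ∀ x ∈ K, σ Q x ≤ σ Q z := fun x hx => by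
        rw [← hfQ x (hKQ hx), ← hfQ z (hKQ hzK)]
        by_contra hlt
        exact absurd (hzmax x hx) (hlex z x (not_le.1 hlt)).not_ge
      refine Set.disjoint_left.1 hTb hzT ⟨K, hK, hAK, hKQ, hzK, hle, fun x hx => ?_⟩
      refine (hle x (hAK hx)).lt_of_ne fun h => ?_
      exact absurd (hzA x hx) (hinjQ h ▸ lt_irrefl _)
    · obtain ⟨y, hyK, hyC⟩ := Set.not_disjoint_iff.1 hKC
      have hzC : z ∈ C := by
        by_contra hzC
        exact absurd (hzmax y hyK) (hCn y z hyC hzC).not_ge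
      exact Set.disjoint_left.1 hTZ hzT (.inr ⟨hzC, hKS hzK⟩)
  · obtain ⟨y, hyA, hymax⟩ := IsHull.exists_max (ρ := ρ) hA
    have hyC : y ∈ C := by
      obtain ⟨x, hxA, hxC⟩ := Set.not_disjoint_iff.1 hAC
      by_contra hyC
      exact absurd (hymax x hxA) (hCn x y hxC hyC).not_ge
    set W := {w ∈ C ∩ S | ρ y < ρ w} with hW
    have hWcard : W.ncard < (C ∩ S).ncard := Set.ncard_lt_ncard
      ⟨fun _ hw => hw.1, fun h => lt_irrefl _ (h (a := y) ⟨hyC, hAS hyA⟩).2⟩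
    refine ⟨X \ W, fun x hx => ⟨hSX (hAS hx), fun h => absurd (hymax x hx) h.2.not_ge⟩,
      hXZ.mono_left Set.sdiff_subset, Set.disjoint_left.2 ?_, ?_⟩
    · rintro z hzT ⟨K, hK, hAK, hKS, hzK, -, hzA⟩
      have hzC : z ∈ C := by
        by_contra hzC
        exact absurd (hzA y hyA) (hCn y z hyC hzC).not_gt
      exact hzT.2 ⟨⟨hzC, hKS hzK⟩, hzA y hyA⟩
    · have h1 : outNbr G (X \ W) ⊆ outNbr G X ∪ W := by
        rintro w ⟨hw, u, hu, huw⟩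
        by_cases hwX : w ∈ X
        · exact .inr (by_contra fun h => hw ⟨hwX, h⟩)
        · exact .inl ⟨hwX, u, hu.1, huw⟩
      have h2 := (Set.ncard_le_ncard h1).trans (Set.ncard_union_le _ _)
      omega

end

/-! ### From positional winning to the cop-monotone strategy -/

/-- The vertices that a robber in `p.robber` can reach if the cops stay where they are. -/
def territory (G : Digraph V) (p : Position V) : Set V :=
  {v | ∃ u ∈ p.robber, Reaches G p.cops u v}

theorem IsComponent.rooted_territory {p : Position V} (h : IsComponent G p.cops p.robber) {r : V}
    (hr : r ∈ p.robber) : territory G p = reachSet G p.copsᶜ r := by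
  obtain ⟨v, hv, hR⟩ := h
  rw [hR] at hr
  refine Set.Subset.antisymm ?_ fun w hw => ⟨r, by rw [hR]; exact hr, hw⟩
  rintro w ⟨u, hu, huw⟩
  rw [hR] at hu
  exact ReachIn.trans hr.2 (ReachIn.trans hu.1 huw)

theorem IsComponent.nonempty {X R : Set V} (h : IsComponent G X R) : R.Nonempty := by
  obtain ⟨v, hv, rfl⟩ := h
  exact ⟨v, ReachIn.refl (U := Xᶜ) hv, ReachIn.refl (U := Xᶜ) hv⟩

theorem outNbr_territory_subset (p : Position V) : outNbr G (territory G p) ⊆ p.cops := by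
  rintro w ⟨hw, v, ⟨u, hu, huv⟩, hvw⟩
  by_contra hwC
  exact hw ⟨u, hu, ReachIn.tail (U := p.copsᶜ) huv hvw hwC⟩

theorem disjoint_territory (p : Position V) : Disjoint (territory G p) p.cops := by
  rw [Set.disjoint_left]
  rintro v ⟨u, -, huv⟩
  exact ReachIn.right_mem (U := p.copsᶜ) huv

theorem getLast?_history (π : ℕ → Position V) (i : ℕ) : (history π i).getLast? = some (π i) := by
  simp [history, List.range_succ]

/-- On a territory with a root, the cops may place at least one new cop. -/
theorem WinsFrom.exists_nonempty {q : ℕ} {U : Set V} (h : WinsFrom G q U) :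
    ∀ {r : V}, Rooted G r U → ∃ W ⊆ U, W.Nonempty ∧ (outNbr G U ∪ W).ncard ≤ q ∧
      ∀ r ∈ U \ W, WinsFrom G q (reachSet G (U \ W) r) := by
  induction h with
  | place U W hWU hq h ih =>
    intro r hr
    rcases W.eq_empty_or_nonempty with rfl | hW
    · have h1 := ih r ⟨hr.1, Set.notMem_empty r⟩ (rooted_reachSet ⟨hr.1, Set.notMem_empty r⟩)
      rwa [Set.sdiff_empty, hr.reachSet_eq] at h1
    · exact ⟨W, hWU, hW, hq, h⟩

/-- If the cops win from all initial territories, then they have a cop-monotone strategy: they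
occupy the out-neighbours of the robber territory together with the new vertices. -/
theorem copsWinStronglyMonotone_of_winsFrom [Finite V] {q : ℕ}
    (h : ∀ r, WinsFrom G q (reachSet G Set.univ r)) : CopsWinStronglyMonotone G q := by
  have hex : ∀ U, ∃ W, (∃ r, Rooted G r U) → WinsFrom G q U → W ⊆ U ∧ W.Nonempty ∧
      (outNbr G U ∪ W).ncard ≤ q ∧ ∀ r ∈ U \ W, WinsFrom G q (reachSet G (U \ W) r) := by
    intro U
    by_cases hU : (∃ r, Rooted G r U) ∧ WinsFrom G q U
    · obtain ⟨⟨r, hr⟩, hU⟩ := hU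
      obtain ⟨W, hW⟩ := hU.exists_nonempty hr
      exact ⟨W, fun _ _ => hW⟩
    · exact ⟨∅, fun h1 h2 => absurd ⟨h1, h2⟩ hU⟩
  choose w hw using hex
  refine ⟨fun L => L.getLast?.elim ∅ fun p => outNbr G (territory G p) ∪ w (territory G p),
    fun π hπ => ?_⟩
  obtain ⟨h0, hR0, hstep⟩ := hπ
  set U : ℕ → Set V := fun i => territory G (π i) with hU
  have hcops : ∀ i, (π (i + 1)).cops = outNbr G (U i) ∪ w (U i) := fun i => by
    rw [(hstep i).1]
    simp only [getLast?_history, Option.elim_some, hU]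
  have hmove : ∀ i, (π (i + 1)).robber.Nonempty → (π i).robber.Nonempty ∧
      ReachMove G (π i).cops (π (i + 1)).cops (π i).robber (π (i + 1)).robber := by
    intro i hi
    rcases (hstep i).2 with h1 | h1
    · exact h1
    · rw [h1.1] at hi; exact absurd hi Set.not_nonempty_empty
  have hcomp : ∀ i, (π i).robber.Nonempty → IsComponent G (π i).cops (π i).robber := by
    rintro (_ | i) hi
    · rwa [h0]
    · exact (hmove i hi).2.1
  have hroot : ∀ i, (π i).robber.Nonempty → ∃ r, Rooted G r (U i) := by
    rintro i ⟨r, hr⟩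
    have hc := hcomp i ⟨r, hr⟩
    refine ⟨r, ?_⟩
    simp only [hU, hc.rooted_territory hr]
    refine rooted_reachSet ?_
    obtain ⟨v, hv, hR⟩ := hc
    rw [hR] at hr
    exact ReachIn.right_mem (U := (π i).copsᶜ) hr.1
  -- the next territory arises from the present one by removing the new vertices
  have hnext : ∀ i, (π (i + 1)).robber.Nonempty → w (U i) ⊆ U i →
      ∃ r ∈ U i \ w (U i), U (i + 1) = reachSet G (U i \ w (U i)) r := by
    intro i hi hwU
    obtain ⟨-, hc, u, hu, r, hr, hur⟩ := hmove i hi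
    have hN : outNbr G (U i) ⊆ (π i).cops ∩ (π (i + 1)).cops := fun x hx =>
      ⟨outNbr_territory_subset _ hx, by rw [hcops]; exact .inl hx⟩
    have hstay : ∀ X : Set V, (outNbr G (U i)) ⊆ X → ∀ x y, x ∈ U i → ReachIn G Xᶜ x y →
        ReachIn G (Xᶜ ∩ U i) x y := by
      intro X hX x y hx hxy
      refine hxy.inter_of_closed hx ?_
      rintro a ⟨-, ha⟩ b hb hab
      by_contra hbU
      exact hb (hX ⟨hbU, a, ha, hab⟩)
    have huU : u ∈ U i := by
      obtain ⟨v, hv, hR⟩ := hcomp i (hmove i hi).1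
      refine ⟨u, hu, ReachIn.refl (U := (π i).copsᶜ) ?_⟩
      rw [hR] at hu
      exact ReachIn.right_mem (U := (π i).copsᶜ) hu.1
    have hrU : r ∈ U i := (hstay _ hN u r huU hur).right_mem.2
    have hrC : r ∉ (π (i + 1)).cops := by
      obtain ⟨v, hv, hR⟩ := hc
      rw [hR] at hr
      exact ReachIn.right_mem (U := (π (i + 1)).copsᶜ) hr.1
    have hdiff : (π (i + 1)).copsᶜ ∩ U i = U i \ w (U i) := by
      ext x
      rw [hcops]
      constructor
      · exact fun hx => ⟨hx.2, fun hxw => hx.1 (.inr hxw)⟩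
      · exact fun hx => ⟨fun h => h.elim (fun h => h.1 hx.1) hx.2, hx.1⟩
    refine ⟨r, hdiff ▸ ⟨hrC, hrU⟩, ?_⟩
    have : U (i + 1) = reachSet G (π (i + 1)).copsᶜ r := hc.rooted_territory hr
    rw [this, ← hdiff]
    refine Set.Subset.antisymm (fun x hx => ?_) fun x hx => ReachIn.mono Set.inter_subset_left hx
    exact hstay _ (fun x hx => (hN hx).2) r x hrU hx
  have hwin : ∀ i, (π i).robber.Nonempty → WinsFrom G q (U i) := by
    intro i
    induction i with
    | zero =>
      rintro ⟨r, hr⟩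
      have : U 0 = reachSet G (π 0).copsᶜ r := (hcomp 0 ⟨r, hr⟩).rooted_territory hr
      rw [this, h0, Set.compl_empty]
      exact h r
    | succ i ih =>
      intro hi
      have hi' := (hmove i hi).1
      have hw' := hw (U i) (hroot i hi') (ih hi')
      obtain ⟨r, hr, hUr⟩ := hnext i hi hw'.1
      rw [hUr]
      exact hw'.2.2.2 r hr
  have hw' := fun i hi => hw (U i) (hroot i hi) (hwin i hi)
  have hlt : ∀ i, (π (i + 1)).robber.Nonempty → U (i + 1) ⊂ U i := by
    intro i hi
    have h1 := hw' i (hmove i hi).1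
    obtain ⟨r, hr, hUr⟩ := hnext i hi h1.1
    obtain ⟨x, hx⟩ := h1.2.1
    have hsub : U (i + 1) ⊆ U i \ w (U i) := hUr ▸ reachSet_subset
    exact ⟨hsub.trans Set.sdiff_subset, fun h => (hsub (h (h1.1 hx))).2 hx⟩
  have hend : ∃ n, (π n).robber = ∅ := by
    by_contra! hne
    have : ∀ i, (U i).ncard + i ≤ (U 0).ncard := by
      intro i
      induction i with
      | zero => exact le_rfl
      | succ i ih =>
        have := Set.ncard_lt_ncard (hlt i (hne _))
        omega
    have := this ((U 0).ncard + 1)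
    omega
  classical
  have hfirst : ∀ i < Nat.find hend, (π i).robber.Nonempty := fun i hi =>
    Set.nonempty_iff_ne_empty.2 (Nat.find_min hend hi)
  refine ⟨Nat.find hend, Nat.find_spec hend, hfirst, ?_, ?_⟩
  · have hanti : ∀ i l, i ≤ l → l < Nat.find hend → U l ⊆ U i := by
      intro i l hil
      induction hil with
      | refl => exact fun _ => subset_rfl
      | step _ ih => exact fun hl => (hlt _ (hfirst _ hl)).1.trans (ih (by omega))
    intro i m l him hml hl v hv
    obtain ⟨m, rfl⟩ : ∃ m', m = m' + 1 := ⟨m - 1, by omega⟩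
    obtain ⟨l, rfl⟩ : ∃ l', l = l' + 1 := ⟨l - 1, by omega⟩
    have hvm : v ∈ outNbr G (U m) ∪ U m := by
      have hvl := hv.2
      rw [hcops] at hvl
      rcases hvl with h1 | h1
      · exact outNbr_subset_union (hanti m l (by omega) (by omega)) h1
      · exact .inr (hanti m l (by omega) (by omega) ((hw' l (hfirst l (by omega))).1 h1))
    rw [hcops]
    refine .inl (hvm.resolve_right fun h1 => ?_)
    exact Set.disjoint_left.1 (disjoint_territory (π i))
      (hanti i m (by omega) (by omega) h1) hv.1
  · rintro (_ | i) hi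
    · simp [h0]
    · rw [hcops, ← (Set.toFinite _).cast_ncard_eq]
      exact_mod_cast (hw' i (hfirst i (by omega))).2.2.1

/-! ### From a strategy against the shy robber to an order -/

/-- The rounds before round `i` of `π` are played according to the rules and to `σ`. -/
def IsConsistentUpTo (G : Digraph V) (mv : Set V → Set V → Set V → Set V → Prop)
    (σ : CopStrategy V) (π : ℕ → Position V) (i : ℕ) : Prop :=
  (π 0).cops = ∅ ∧ IsComponent G ∅ (π 0).robber ∧
    ∀ l < i, (π (l + 1)).cops = σ (history π l) ∧
      RobberStep mv (π l).cops (π (l + 1)).cops (π l).robber (π (l + 1)).robber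

theorem history_congr {π π' : ℕ → Position V} {i : ℕ} (h : ∀ l ≤ i, π l = π' l) :
    history π i = history π' i :=
  List.map_congr_left fun l hl => h l (by simpa [Nat.lt_succ_iff] using hl)

/-- A play can be continued from round `i` on by any rule. -/
theorem exists_extension (next : List (Position V) → Position V) (π₀ : ℕ → Position V) (i : ℕ) :
    ∃ π : ℕ → Position V, (∀ l ≤ i, π l = π₀ l) ∧ ∀ l, i ≤ l → π (l + 1) = next (history π l) := by
  let P : ℕ → ℕ → Position V := fun n => n.rec π₀ fun n p =>
    Function.update p (n + 1) (if n + 1 ≤ i then π₀ (n + 1) else next (history p n))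
  have hsucc : ∀ n, P (n + 1) = Function.update (P n) (n + 1)
      (if n + 1 ≤ i then π₀ (n + 1) else next (history (P n) n)) := fun n => rfl
  have hstab : ∀ n l, l ≤ n → P n l = P l l := by
    intro n l hl
    induction hl with
    | refl => rfl
    | step hl ih => rw [hsucc, Function.update_of_ne (by simp at hl; omega), ih]
  refine ⟨fun l => P l l, fun l hl => ?_, fun l hl => ?_⟩
  · cases l with
    | zero => rfl
    | succ l => simp only [hsucc, Function.update_self, if_pos hl]
  · have : history (fun l => P l l) l = history (P l) l :=
      history_congr fun m hm => (hstab l m hm).symm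
    simp only [this, hsucc, Function.update_self]
    rw [if_neg (by omega)]

theorem IsComponent.stronglyConn {X R : Set V} (h : IsComponent G X R) : StronglyConn G R := by
  obtain ⟨v, hv, rfl⟩ := h
  exact stronglyConn_sccOf (U := Xᶜ) hv

theorem IsComponent.disjoint {X R : Set V} (h : IsComponent G X R) : Disjoint R X := by
  obtain ⟨v, hv, rfl⟩ := h
  exact Set.disjoint_left.2 fun w hw => sccOf_subset (U := Xᶜ) hw

theorem StronglyConn.exists_isComponent {A X : Set V} (hA : StronglyConn G A)
    (hAX : Disjoint A X) : ∃ R, IsComponent G X R ∧ A ⊆ R := by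
  obtain ⟨v, hv⟩ := hA.1
  have hAX' : A ⊆ Xᶜ := Set.subset_compl_iff_disjoint_right.2 hAX
  exact ⟨sccOf G Xᶜ v, ⟨v, hAX' hv, rfl⟩, hA.subset_sccOf hAX' hv (mem_sccOf (hAX' hv))⟩

/-- A shy robber on a strongly connected `K` can stay there while no cop is placed on `K`. -/
theorem compMove_of_subset {C C' R R' K : Set V} (hR : IsComponent G C R) (hKR : K ⊆ R)
    (hK : StronglyConn G K) (hR' : IsComponent G C' R') (hKR' : K ⊆ R') : CompMove G C C' R R' := by
  refine ⟨hR', ?_⟩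
  have hne : (R ∩ R').Nonempty := hK.1.mono (Set.subset_inter hKR hKR')
  have h1 := hR.stronglyConn.union hR'.stronglyConn hne
  obtain ⟨S, hS, hsub⟩ := h1.exists_isComponent (X := C ∩ C') (Set.disjoint_union_left.2
    ⟨hR.disjoint.mono_right Set.inter_subset_left, hR'.disjoint.mono_right Set.inter_subset_right⟩)
  exact ⟨S, hS, Set.union_subset_iff.1 hsub⟩

theorem exists_robberStep {C C' R K : Set V} (hK : StronglyConn G K) :
    ∃ R', RobberStep (CompMove G) C C' R R' ∧
      (IsComponent G C R → K ⊆ R → Disjoint K C' → K ⊆ R') := by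
  by_cases h : IsComponent G C R ∧ K ⊆ R ∧ Disjoint K C'
  · obtain ⟨h1, h2, h3⟩ := h
    obtain ⟨R', hR', hKR'⟩ := hK.exists_isComponent h3
    exact ⟨R', .inl ⟨h1.nonempty, compMove_of_subset h1 h2 hK hR' hKR'⟩, fun _ _ _ => hKR'⟩
  · have hno : IsComponent G C R → K ⊆ R → Disjoint K C' → False := fun h1 h2 h3 => h ⟨h1, h2, h3⟩
    by_cases hmv : R.Nonempty ∧ ∃ S, CompMove G C C' R S
    · obtain ⟨hR, S, hS⟩ := hmv
      exact ⟨S, .inl ⟨hR, hS⟩, fun h1 h2 h3 => (hno h1 h2 h3).elim⟩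
    · exact ⟨∅, .inr ⟨rfl, fun hR S hS => hmv ⟨hR, S, hS⟩⟩, fun h1 h2 h3 => (hno h1 h2 h3).elim⟩

theorem IsConsistentUpTo.isComponent {σ : CopStrategy V} {π : ℕ → Position V} {i : ℕ}
    (h : IsConsistentUpTo G (CompMove G) σ π i) {l : ℕ} (hl : l ≤ i)
    (hne : (π l).robber.Nonempty) : IsComponent G (π l).cops (π l).robber := by
  obtain ⟨h0, hR, hstep⟩ := h
  cases l with
  | zero => rwa [h0]
  | succ l =>
    rcases (hstep l hl).2 with h1 | h1
    · exact h1.2.1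
    · rw [h1.1] at hne; exact absurd hne Set.not_nonempty_empty

/-- Against a winning strategy, a robber sitting on a strongly connected `K` is eventually attacked
there; by weak monotonicity it then cannot reach the vertices chased before. -/
theorem exists_attack {σ : CopStrategy V} {k : ℕ}
    (hσ : ∀ π, IsConsistentPlay G (CompMove G) σ π → ∃ n, (π n).robber = ∅ ∧
      (∀ i < n, (π i).robber.Nonempty) ∧ WeaklyMonotone G π n ∧ ∀ i ≤ n, (π i).cops.encard ≤ k)
    {π₀ : ℕ → Position V} {i : ℕ} (h₀ : IsConsistentUpTo G (CompMove G) σ π₀ i) {K : Set V}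
    (hK : StronglyConn G K) (hKR : K ⊆ (π₀ i).robber) :
    ∃ π l, i ≤ l ∧ (∀ m ≤ i, π m = π₀ m) ∧ IsConsistentUpTo G (CompMove G) σ π (l + 1) ∧
      K ⊆ (π l).robber ∧ ((π (l + 1)).cops ∩ K).Nonempty ∧ (π (l + 1)).cops.encard ≤ k ∧
      ∀ m < l, ∀ u ∈ (π l).robber, ∀ v ∈ chasers π m,
        ¬ Reaches G ((π l).cops ∩ (π (l + 1)).cops) u v := by
  have hex := fun C C' R : Set V => exists_robberStep (C := C) (C' := C') (R := R) hK
  choose g hg hgK using hex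
  obtain ⟨π, hπ₀, hπ⟩ := exists_extension (fun L => L.getLast?.elim ⟨∅, ∅⟩ fun p =>
    ⟨σ L, g p.cops (σ L) p.robber⟩) π₀ i
  have hnext : ∀ l, i ≤ l → π (l + 1) =
      ⟨σ (history π l), g (π l).cops (σ (history π l)) (π l).robber⟩ := fun l hl => by
    rw [hπ l hl]
    simp only [getLast?_history, Option.elim_some]
  have hcons : IsConsistentPlay G (CompMove G) σ π := by
    refine ⟨by rw [hπ₀ 0 (Nat.zero_le i)]; exact h₀.1,
      by rw [hπ₀ 0 (Nat.zero_le i)]; exact h₀.2.1, fun l => ?_⟩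
    rcases lt_or_ge l i with hl | hl
    · rw [hπ₀ l hl.le, hπ₀ (l + 1) hl, history_congr fun m hm => hπ₀ m (hm.trans hl.le)]
      exact h₀.2.2 l hl
    · rw [hnext l hl]
      exact ⟨rfl, hg _ _ _⟩
  have hup : ∀ m, IsConsistentUpTo G (CompMove G) σ π m := fun m =>
    ⟨hcons.1, hcons.2.1, fun l _ => hcons.2.2 l⟩
  obtain ⟨n, hn, -, hmon, hcard⟩ := hσ π hcons
  have hdead : ∀ m, n ≤ m → (π m).robber = ∅ := by
    intro m hm
    induction hm with
    | refl => exact hn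
    | step _ ih =>
      rcases (hcons.2.2 _).2 with h | h
      · rw [ih] at h; exact absurd h.1 Set.not_nonempty_empty
      · exact h.1
  have hlt : ∀ m, K ⊆ (π m).robber → m < n := fun m hm => by
    by_contra hmn
    rw [hdead m (not_lt.1 hmn)] at hm
    exact Set.not_nonempty_empty (hK.1.mono hm)
  have hattack : ∃ l, i ≤ l ∧ K ⊆ (π l).robber ∧ ((π (l + 1)).cops ∩ K).Nonempty := by
    by_contra! hno
    have hstay : ∀ m, i ≤ m → K ⊆ (π m).robber := by
      intro m hm
      induction hm with
      | refl => rw [hπ₀ i le_rfl]; exact hKR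
      | @step m hm ih =>
        have hd := hno m hm ih
        rw [hnext m hm] at hd ⊢
        exact hgK _ _ _ ((hup m).isComponent le_rfl (hK.1.mono ih)) ih
          (Set.disjoint_iff_inter_eq_empty.2 (by rw [Set.inter_comm]; exact hd))
    exact absurd (hlt (n + i) (hstay _ (by omega))) (by omega)
  obtain ⟨l, hil, hKl, hC⟩ := hattack
  have hln := hlt l hKl
  exact ⟨π, l, hil, hπ₀, hup _, hKl, hC, hcard (l + 1) hln,
    fun m hm u hu v hv => hmon l m hm hln u hu v hv⟩

/-- A winning strategy against the shy robber orders each strongly connected `K` on which the robber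
may be sitting: the vertices on which it is attacked come last, and the hulls avoid the vertices
chased so far. -/
theorem hasHullOrder_of_strategy [Finite V] {σ : CopStrategy V} {j : ℕ}
    (hσ : ∀ π, IsConsistentPlay G (CompMove G) σ π → ∃ n, (π n).robber = ∅ ∧
      (∀ i < n, (π i).robber.Nonempty) ∧ WeaklyMonotone G π n ∧
        ∀ i ≤ n, (π i).cops.encard ≤ (j + 1 : ℕ)) (n : ℕ) :
    ∀ {K : Set V}, K.ncard ≤ n → StronglyConn G K → ∀ {π : ℕ → Position V} {i : ℕ},
      IsConsistentUpTo G (CompMove G) σ π i → K ⊆ (π i).robber →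
      HasHullOrder G j K {v | ∃ m < i, v ∈ chasers π m} := by
  induction n with
  | zero =>
    intro K hn hK
    exact absurd ((Set.ncard_eq_zero (s := K)).1 (Nat.le_zero.1 hn)) hK.1.ne_empty
  | succ n ih =>
  intro K hn hK π₀ i h₀ hKR₀
  obtain ⟨π, l, hil, hπ₀, hcons, hKR, hattack, hcard, hmon⟩ := exists_attack hσ h₀ hK hKR₀
  have hcomp := hcons.isComponent (Nat.le_succ l) (hK.1.mono hKR)
  have hchase : ∀ {π' : ℕ → Position V} {m : ℕ}, π' m = π m →
      (π' (m + 1)).cops = (π (m + 1)).cops → chasers π' m = chasers π m :=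
    fun h1 h2 => by rw [chasers, chasers, h1, h2]
  set C := (π (l + 1)).cops with hCdef
  set B := (π l).cops ∩ C with hB
  set X := {v | ∃ u ∈ (π l).robber, Reaches G B u v} with hX
  have hRX : (π l).robber ⊆ X := fun u hu => ⟨u, hu, ReachIn.refl (U := Bᶜ)
    fun h => Set.disjoint_left.1 hcomp.disjoint hu h.1⟩
  have hNX : outNbr G X ⊆ B := by
    rintro w ⟨hw, v, ⟨u, hu, huv⟩, hvw⟩
    by_contra hwB
    exact hw ⟨u, hu, ReachIn.tail (U := Bᶜ) huv hvw hwB⟩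
  have key : HasHullOrder G j K {v | ∃ m < l, v ∈ chasers π m} := by
    refine HasHullOrder.glue (C := C) (X := X) (hKR.trans hRX) ?_ ?_ ?_
    · rw [Set.disjoint_left]
      rintro v ⟨u, hu, huv⟩ ⟨m, hm, hv⟩
      exact hmon m hm u hu v hv huv
    · have hd : Disjoint (outNbr G X) (C ∩ K) := Set.disjoint_left.2 fun v hv hv' =>
        Set.disjoint_left.1 hcomp.disjoint (hKR hv'.2) (hNX hv).1
      rw [← Set.ncard_union_eq hd]
      refine (Set.ncard_le_ncard (Set.union_subset (hNX.trans Set.inter_subset_right)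
        Set.inter_subset_left)).trans ?_
      rw [← (Set.toFinite _).cast_ncard_eq] at hcard
      exact_mod_cast hcard
    · intro r hr
      have hK' := isScc_sccOf (G := G) hr
      set K' := sccOf G (K \ C) r with hK'def
      have hK'K : K' ⊆ K := hK'.subset.trans Set.sdiff_subset
      obtain ⟨x, hxC, hxK⟩ := hattack
      have hlt : K'.ncard < K.ncard :=
        Set.ncard_lt_ncard ⟨hK'K, fun h => (hK'.subset (h hxK)).2 hxC⟩
      obtain ⟨R', hR', hKR'⟩ := hK'.conn.exists_isComponent (X := C)
        (Set.disjoint_left.2 fun v hv => (hK'.subset hv).2)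
      -- the play in which the robber moves to the component containing `K'`
      set π' := Function.update π (l + 1) ⟨C, R'⟩ with hπ'
      have hsame : ∀ m ≤ l, π' m = π m := fun m hm => Function.update_of_ne (by omega) _ _
      have hlast : π' (l + 1) = ⟨C, R'⟩ := Function.update_self _ _ _
      have hcops : ∀ m ≤ l, (π' (m + 1)).cops = (π (m + 1)).cops := by
        intro m hm
        rcases hm.lt_or_eq with h | rfl
        · rw [hsame (m + 1) h]
        · rw [hlast]
      have hcons' : IsConsistentUpTo G (CompMove G) σ π' (l + 1) := by
        refine ⟨by rw [hsame 0 (Nat.zero_le l)]; exact hcons.1,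
          by rw [hsame 0 (Nat.zero_le l)]; exact hcons.2.1, fun m hm => ?_⟩
        have hm' : m ≤ l := Nat.lt_succ_iff.1 hm
        have hst := hcons.2.2 m hm
        refine ⟨?_, ?_⟩
        · rw [hcops m hm', hst.1, history_congr fun a ha => (hsame a (ha.trans hm')).symm]
        · rcases hm'.lt_or_eq with h | rfl
          · rw [hsame m hm', hsame (m + 1) h]
            exact hst.2
          · rw [hsame m le_rfl, hlast]
            exact .inl ⟨hcomp.nonempty, compMove_of_subset hcomp (hK'K.trans hKR) hK'.conn hR' hKR'⟩
      refine (ih (by omega) hK'.conn hcons' (by rw [hlast]; exact hKR')).mono ?_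
      rintro v (⟨m, hm, hv⟩ | hv)
      · exact ⟨m, by omega, by rwa [hchase (hsame m hm.le) (hcops m hm.le)]⟩
      · refine ⟨l, by omega, ?_⟩
        rw [hchase (hsame l le_rfl) (hcops l le_rfl)]
        exact ⟨hv.1, hKR hv.2⟩
  refine key.mono ?_
  rintro v ⟨m, hm, hv⟩
  refine ⟨m, by omega, ?_⟩
  rwa [hchase (hπ₀ m hm.le).symm (by rw [hπ₀ (m + 1) hm])] at hv

/-- Every winning strategy against the shy robber yields a hull system. -/
theorem exists_isHullSystem_of_copsWin [Finite V] [Nonempty V] {k : ℕ}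
    (h : CopsWinWeaklyMonotoneShy G k) :
    ∃ j, k = j + 1 ∧ ∃ top T, IsHullSystem G j top T := by
  obtain ⟨σ, hσ⟩ := h
  have hstart : ∀ r : V, IsConsistentUpTo G (CompMove G) σ
      (fun _ => ⟨∅, sccOf G Set.univ r⟩) 0 := fun r =>
    ⟨rfl, ⟨r, Set.notMem_empty r, by rw [← Set.compl_empty]; rfl⟩, fun l hl => absurd hl (by omega)⟩
  obtain ⟨j, rfl⟩ : ∃ j, k = j + 1 := by
    obtain ⟨r⟩ := ‹Nonempty V›
    obtain ⟨π, l, -, -, -, -, hne, hcard, -⟩ := exists_attack hσ (hstart r)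
      (stronglyConn_sccOf (Set.mem_univ r)) subset_rfl
    refine Nat.exists_eq_succ_of_ne_zero ?_
    rintro rfl
    have : (π (l + 1)).cops = ∅ := by simpa using hcard
    rw [this, Set.empty_inter] at hne
    exact Set.not_nonempty_empty hne
  refine ⟨j, rfl, HasHullOrder.exists_isHullSystem (Z := ∅) ?_⟩
  refine HasHullOrder.glue (C := ∅) subset_rfl (Set.disjoint_empty _) ?_ fun r _ => ?_
  · have : outNbr G (Set.univ : Set V) = ∅ :=
      Set.eq_empty_of_forall_notMem fun x hx => hx.1 trivial
    simp [this]
  · rw [Set.sdiff_empty]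
    refine (hasHullOrder_of_strategy hσ _ le_rfl (stronglyConn_sccOf (Set.mem_univ r)) (hstart r)
      subset_rfl).mono ?_
    simp

end GraphSearching

theorem mainTheorem1 {V : Type*} [Finite V] (G : Digraph V) (k : ℕ)
    (h : GraphSearching.CopsWinWeaklyMonotoneShy G k) :
    GraphSearching.CopsWinStronglyMonotone G (18 * k ^ 2 + 3 * k) := by
  cases isEmpty_or_nonempty V with
  | inl hV =>
    -- without vertices there is no play
    exact ⟨fun _ => ∅, fun π hπ => (IsEmpty.false hπ.2.1.choose).elim⟩
  | inr hV =>
    obtain ⟨j, rfl, top, T, hT⟩ := GraphSearching.exists_isHullSystem_of_copsWin h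
    exact GraphSearching.copsWinStronglyMonotone_of_winsFrom hT.winsFrom
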